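/- Let $\Sigma$ and $\Gamma$ be finite alphabets and let $\#$ be a padding symbol in neither. Let $f\colon\Sigma^*\to\Gamma^*$ be a transduction computed by an S-RASP program with minimum vector length $q$. Then $f$ is computed, with the same minimum vector length $q$, by a masked average-hard attention transformer encoder whose position encoding consists only of $i/n$ and $1/(i+2)^2$. *Computing a transduction.* A device mapping vectors in $(\Sigma\cup\{\#\})^n$ to vectors of length $n$ computes $f$ with minimum vector length $q$ if $q\colon\mathbb N\to\mathbb N$ is nondecreasing and, for all $w\in\Sigma^*$, $q(|w|)\ge|f(w)|$ and for all $n>\max(|w|,q(|w|))$ its output on $w\#^{n-|w|}$ is $f(w)\#^{n-|f(w)|}$. *S-RASP.* A program is a finite sequence of definitions of vectors of length $n$, of type bool, char (values in a finite alphabet $\Delta\supseteq\Sigma\cup\Gamma\cup\{\#\}$) or nat (values in $\{0,\dots,n-1\}$), starting from the input vector $\mathrm{in}$ and $\mathrm{pos}(i)=i$; a char vector is designated as the output. Integer results are clipped to $\{0,\dots,n-1\}$. Expressions are built from entries $P(x)$ of previously defined vectors, where $x$ is a position variable, with $\top,\bot,\land,\lor,\lnot$, symbols, equality of symbols, $0,1,+,-$,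 integer comparisons containing at most one position variable, and conditionals. A definition $P(i)=\cdots$ is one of: an expression in $i$; a prefix sum $\sum_{j\le i}V(j)$ of an integer expression $V(j)$; or a leftmost or rightmost attention operation, whose value is $V(j)$ for the least (resp. greatest) $j$ with $M(i,j)\wedge S(i,j)$, and $D(i)$ if there is no such $j$. Here $M(i,j)$ is one of $\top,\ j<i,\ j\le i,\ j>i,\ j\ge i$; $S(i,j)$ is a Boolean expression in $i,j$ or a test $V_1(i)=V_2(j)$ between previously defined integer vectors; and $V(j)$, $D(i)$ are expressions of the type of $P$ in the one variable indicated. *Transformers.* An encoder has a dimension $d$ and a finite list of layers, both independent of $n$ and of the input. It acts on sequences $u_{-1},u_0,\dots,u_{n-1}\in\mathbb R^d$. A position-wise layer is $u_i'=u_i+F(u_i)$ with $F$ a two-layer ReLU feed-forward network (with biases). An average-hard attention layer, given by linear maps $Q,K,V\colon\mathbb R^d\to\mathbb R^d$, is $u_i'=u_i+\frac1{|M_i|}\sum_{j\in M_i}Vu_j$, where $M_i$ is the set of allowed positions $j$ maximizing $\langle Qu_i,Ku_j\rangle$; all positions are allowed, or only $j<i$, or only $j\le i$; if no position is allowed, $u_i'=u_i$.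 Fix any orderings of $\Sigma\cup\{\#\}$ and $\Gamma\cup\{\#\}$, and let $k=|\Sigma|+1$, $k'=|\Gamma|+1$, where $d\ge k+2$ and $d\ge k'$. Initially, the first $k$ coordinates of $u_i$ hold the one-hot encoding of the $i$-th symbol of the padded input (zero for $i=-1$), the next two hold $i/n$ and $1/(i+2)^2$, and the rest are $0$. The output is the vector whose one-hot encoding is held by the first $k'$ coordinates of the final $u_0,\dots,u_{n-1}$; these coordinates of the final $u_{-1}$ must be $0$. -/

import Mathlib

/-! ## Transductions on padded vectors

The padding symbol is `none`, so `Option A` is the alphabet `A` together with the padding symbol. -/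

/-- The vector `w · pad^(n - |w|)` of length `n` (used when `w.length < n`). -/
def padTo {A : Type*} (n : ℕ) (w : List A) : Fin n → Option A := fun i => w[i.val]?

/-- `R n a b` says that a device, run on the vector `a` of length `n`, outputs the vector `b`.
`ComputesWith R f q` says that the device computes the transduction `f` with minimum vector
length `q`: for every input `w` and every `n` exceeding both `|w|` and `q |w|`, running on `w`
padded to length `n` yields `f w` padded to length `n`. -/
def ComputesWith {A B : Type*} (R : ∀ n : ℕ, (Fin n → Option A) → (Fin n → Option B) → Prop)
    (f : List A → List B) (q : ℕ → ℕ) : Prop :=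
  Monotone q ∧ ∀ w : List A, (f w).length ≤ q w.length ∧
    ∀ n : ℕ, w.length < n → q w.length < n → R n (padTo n w) (padTo n (f w))

/-! ## S-RASP -/

namespace SRASP

/-- The three types of values. -/
inductive Ty
  | bool
  | char
  | nat

/-- Values; `Δ` is the symbol alphabet. Every operation below keeps integers in `[0, n - 1]`. -/
abbrev Ty.Val (Δ : Type) : Ty → Type
  | .bool => Bool
  | .char => Δ
  | .nat => ℕ

/-- `Name Θ τ`: a name of a vector of type `τ` among the vectors defined so far, whose types
are listed in `Θ` (latest first). -/
inductive Name : List Ty → Ty → Type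
  | here {Θ : List Ty} {τ : Ty} : Name (τ :: Θ) τ
  | there {Θ : List Ty} {σ τ : Ty} : Name Θ τ → Name (σ :: Θ) τ

/-- The contents of all the vectors defined so far, each of length `n`. -/
def Env (Δ : Type) (n : ℕ) (Θ : List Ty) : Type :=
  ∀ τ : Ty, Name Θ τ → Fin n → τ.Val Δ

def Env.nil {Δ : Type} {n : ℕ} : Env Δ n [] := fun _ x => nomatch x

def Env.cons {Δ : Type} {n : ℕ} {Θ : List Ty} {σ : Ty} (v : Fin n → σ.Val Δ)
    (ρ : Env Δ n Θ) : Env Δ n (σ :: Θ)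
  | _, .here => v
  | _, .there x => ρ _ x

/-- Integer comparisons. -/
inductive Cmp
  | eq | ne | lt | le | gt | ge

def Cmp.test : Cmp → ℕ → ℕ → Bool
  | .eq, a, b => decide (a = b)
  | .ne, a, b => decide (a ≠ b)
  | .lt, a, b => decide (a < b)
  | .le, a, b => decide (a ≤ b)
  | .gt, a, b => decide (a > b)
  | .ge, a, b => decide (a ≥ b)

/-- `Expr Δ Θ m τ`: expressions of type `τ` over the vectors `Θ`, with free variables among
`m` position variables. Only `m = 1` (the variable `i`, or `j`) and `m = 2` (variable `0` is
`i`, variable `1` is `j`) are used. Integer comparisons have at most one free variable, hence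
the variable `x` and the one-variable operands in `cmp`. -/
inductive Expr (Δ : Type) (Θ : List Ty) : ℕ → Ty → Type
  | vec {m : ℕ} {τ : Ty} (P : Name Θ τ) (x : Fin m) : Expr Δ Θ m τ
  | ite {m : ℕ} {τ : Ty} (a : Expr Δ Θ m τ) (c : Expr Δ Θ m .bool) (b : Expr Δ Θ m τ) :
      Expr Δ Θ m τ
  | top {m : ℕ} : Expr Δ Θ m .bool
  | bot {m : ℕ} : Expr Δ Θ m .bool
  | and {m : ℕ} (a b : Expr Δ Θ m .bool) : Expr Δ Θ m .bool
  | or {m : ℕ} (a b : Expr Δ Θ m .bool) : Expr Δ Θ m .bool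
  | not {m : ℕ} (a : Expr Δ Θ m .bool) : Expr Δ Θ m .bool
  | charEq {m : ℕ} (a b : Expr Δ Θ m .char) : Expr Δ Θ m .bool
  | cmp {m : ℕ} (x : Fin m) (op : Cmp) (a b : Expr Δ Θ 1 .nat) : Expr Δ Θ m .bool
  | sym {m : ℕ} (δ : Δ) : Expr Δ Θ m .char
  | zero {m : ℕ} : Expr Δ Θ m .nat
  | one {m : ℕ} : Expr Δ Θ m .nat
  | add {m : ℕ} (a b : Expr Δ Θ m .nat) : Expr Δ Θ m .nat
  | sub {m : ℕ} (a b : Expr Δ Θ m .nat) : Expr Δ Θ m .nat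

/-- Replace values greater than `n - 1` by `n - 1`. -/
def clip (n x : ℕ) : ℕ := min x (n - 1)

/-- Value of an expression when the position variables are assigned by `p`. Integer results are
clipped to `[0, n - 1]`; subtraction on `ℕ` already replaces negative results by `0`. -/
def Expr.eval {Δ : Type} [DecidableEq Δ] {n : ℕ} {Θ : List Ty} (ρ : Env Δ n Θ) :
    {m : ℕ} → {τ : Ty} → Expr Δ Θ m τ → (Fin m → Fin n) → τ.Val Δ
  | _, _, .vec P x, p => ρ _ P (p x)
  | _, _, .ite a c b, p => bif c.eval ρ p then a.eval ρ p else b.eval ρ p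
  | _, _, .top, _ => true
  | _, _, .bot, _ => false
  | _, _, .and a b, p => Bool.and (a.eval ρ p) (b.eval ρ p)
  | _, _, .or a b, p => Bool.or (a.eval ρ p) (b.eval ρ p)
  | _, _, .not a, p => Bool.not (a.eval ρ p)
  | _, _, .charEq a b, p => decide (@Eq Δ (a.eval ρ p) (b.eval ρ p))
  | _, _, .cmp x op a b, p => op.test (a.eval ρ (fun _ => p x)) (b.eval ρ (fun _ => p x))
  | _, _, .sym δ, _ => δ
  | _, _, .zero, _ => Nat.zero
  | _, _, .one, _ => clip n 1
  | _, _, .add a b, p => clip n (Nat.add (a.eval ρ p) (b.eval ρ p))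
  | _, _, .sub a b, p => Nat.sub (a.eval ρ p) (b.eval ρ p)

/-- Mask predicates: no masking, future masking (strict or not), past masking (strict or not). -/
inductive Mask
  | none | lt | le | gt | ge

/-- The mask predicate `M(i, j)`. -/
def Mask.test {n : ℕ} : Mask → Fin n → Fin n → Bool
  | .none, _, _ => true
  | .lt, i, j => decide (j < i)
  | .le, i, j => decide (j ≤ i)
  | .gt, i, j => decide (j > i)
  | .ge, i, j => decide (j ≥ i)

inductive Choice
  | leftmost | rightmost

/-- Attention predicates `S(i, j)`: a Boolean expression in `i` and `j`, or an equality test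
`V₁(i) = V₂(j)` between two previously defined integer vectors. -/
inductive AttnPred (Δ : Type) (Θ : List Ty)
  | expr (e : Expr Δ Θ 2 .bool)
  | natEq (V₁ V₂ : Name Θ .nat)

def AttnPred.test {Δ : Type} [DecidableEq Δ] {n : ℕ} {Θ : List Ty} (ρ : Env Δ n Θ)
    (S : AttnPred Δ Θ) (i j : Fin n) : Bool :=
  match S with
  | .expr e => e.eval ρ ![i, j]
  | .natEq V₁ V₂ => decide (@Eq ℕ (ρ _ V₁ i) (ρ _ V₂ j))

/-- Right-hand sides of definitions: position-wise operations, leftmost or rightmost attention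
operations with value `V(j)` and default `D(i)`, and prefix sums of `V(j)` over `j ≤ i`. -/
inductive Op (Δ : Type) (Θ : List Ty) : Ty → Type
  | pointwise {τ : Ty} (e : Expr Δ Θ 1 τ) : Op Δ Θ τ
  | attn {τ : Ty} (c : Choice) (M : Mask) (S : AttnPred Δ Θ) (V D : Expr Δ Θ 1 τ) : Op Δ Θ τ
  | prefixSum (V : Expr Δ Θ 1 .nat) : Op Δ Θ .nat

/-- The vector defined by an operation. -/
def Op.eval {Δ : Type} [DecidableEq Δ] {n : ℕ} {Θ : List Ty} (ρ : Env Δ n Θ) :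
    {τ : Ty} → Op Δ Θ τ → Fin n → τ.Val Δ
  | _, .pointwise e, i => e.eval ρ (fun _ => i)
  | _, .attn c M S V D, i =>
      let s : Finset (Fin n) :=
        Finset.univ.filter (fun j => M.test i j = true ∧ S.test ρ i j = true)
      if h : s.Nonempty then
        match c with
        | .leftmost => V.eval ρ (fun _ => s.min' h)
        | .rightmost => V.eval ρ (fun _ => s.max' h)
      else D.eval ρ (fun _ => i)
  | _, .prefixSum V, i =>
      clip n (Finset.sum (M := ℕ) (Finset.univ.filter (fun j : Fin n => j ≤ i))
        (fun j => V.eval ρ (fun _ => j)))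

/-- A sequence of vector definitions, each using only vectors defined before it, ending with
the designation of a symbol vector as the output. -/
inductive Code (Δ : Type) : List Ty → Type
  | out {Θ : List Ty} (P : Name Θ .char) : Code Δ Θ
  | define {Θ : List Ty} {τ : Ty} (op : Op Δ Θ τ) (rest : Code Δ (τ :: Θ)) : Code Δ Θ

def Code.eval {Δ : Type} [DecidableEq Δ] {n : ℕ} :
    {Θ : List Ty} → Code Δ Θ → Env Δ n Θ → Fin n → Δ
  | _, .out P, ρ => ρ .char P
  | _, .define op rest, ρ => rest.eval (ρ.cons (op.eval ρ))

/-- The initial vectors: `in` (the input symbols) and `pos` (with `pos(i) = i`). -/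
def initEnv {Δ : Type} {n : ℕ} (a : Fin n → Δ) : Env Δ n [.char, .nat] :=
  Env.cons (σ := .char) a (Env.cons (σ := .nat) (fun i => i.val) Env.nil)

/-- An S-RASP program with input alphabet `A` and output alphabet `B`. Its finite symbol
alphabet `Δ` contains the input symbols, the output symbols and the padding symbol. -/
structure Program (A B : Type*) where
  Δ : Type
  [fintypeΔ : Fintype Δ]
  [decEqΔ : DecidableEq Δ]
  inSym : Option A ↪ Δ
  outSym : Option B ↪ Δ
  pad_eq : inSym none = outSym none
  code : Code Δ [.char, .nat]

/-- On the padded input vector `a`, the program outputs the padded vector `b`. -/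
def Program.Outputs {A B : Type*} (P : Program A B) (n : ℕ)
    (a : Fin n → Option A) (b : Fin n → Option B) : Prop :=
  letI := P.decEqΔ
  P.code.eval (initEnv (fun i => P.inSym (a i))) = fun i => P.outSym (b i)

end SRASP

/-! ## Masked average-hard attention transformer encoders

An activation sequence with `n` string positions has the `n + 1` positions `-1, 0, …, n - 1`.
They are indexed by `p : Fin (n + 1)`: index `0` is the default position `-1`, and index `i + 1`
is the string position `i`. -/

noncomputable section

namespace AHAT

/-- Activation sequences of vectors in `ℝ^d`. -/
abbrev Act (d n : ℕ) : Type := Fin (n + 1) → Fin d → ℝ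

/-- A two-layer feed-forward network with ReLU activations. -/
structure FFN (d : ℕ) where
  hidden : ℕ
  W₁ : Matrix (Fin hidden) (Fin d) ℝ
  b₁ : Fin hidden → ℝ
  W₂ : Matrix (Fin d) (Fin hidden) ℝ
  b₂ : Fin d → ℝ

def FFN.apply {d : ℕ} (F : FFN d) (x : Fin d → ℝ) : Fin d → ℝ :=
  F.W₂.mulVec (fun k => max 0 ((F.W₁.mulVec x + F.b₁) k)) + F.b₂

/-- No masking, strict future masking (only `j < i`), non-strict future masking (only `j ≤ i`). -/
inductive Mask
  | none | strictFuture | future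

/-- The positions that position `p` may attend to. -/
def Mask.allowed {n : ℕ} : Mask → Fin (n + 1) → Finset (Fin (n + 1))
  | .none, _ => Finset.univ
  | .strictFuture, p => Finset.univ.filter (fun r => r < p)
  | .future, p => Finset.univ.filter (fun r => r ≤ p)

/-- An average-hard attention layer: query, key and value maps and a mask. -/
structure Attn (d : ℕ) where
  mask : Mask
  Q : (Fin d → ℝ) →ₗ[ℝ] (Fin d → ℝ)
  K : (Fin d → ℝ) →ₗ[ℝ] (Fin d → ℝ)
  V : (Fin d → ℝ) →ₗ[ℝ] (Fin d → ℝ)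

/-- The attention score. -/
def Attn.score {d n : ℕ} (L : Attn d) (u : Act d n) (p r : Fin (n + 1)) : ℝ :=
  dotProduct (L.Q (u p)) (L.K (u r))

/-- The allowed positions of maximal score. -/
def Attn.maximizers {d n : ℕ} (L : Attn d) (u : Act d n) (p : Fin (n + 1)) :
    Finset (Fin (n + 1)) :=
  open Classical in
  (L.mask.allowed p).filter (fun r => ∀ r' ∈ L.mask.allowed p, L.score u p r' ≤ L.score u p r)

inductive Layer (d : ℕ)
  | positionwise (F : FFN d)
  | attention (L : Attn d)

/-- The action of a layer, with residual connection. In an attention layer the values at the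
maximizers are averaged; when there is no allowed position (strict masking at the default
position) the vector is unchanged, the sum being empty. -/
def Layer.apply {d n : ℕ} : Layer d → Act d n → Act d n
  | .positionwise F, u => fun p => u p + F.apply (u p)
  | .attention L, u => fun p =>
      u p + ((L.maximizers u p).card : ℝ)⁻¹ • ∑ r ∈ L.maximizers u p, L.V (u r)

/-- A transformer encoder for `k` input symbols and `k'` output symbols (padding included).
Its dimension and its layers do not depend on the length of the input. -/
structure Encoder (k k' : ℕ) where
  d : ℕ
  input_le : k + 2 ≤ d
  output_le : k' ≤ d
  layers : List (Layer d)

/-- The initial activation sequence: coordinates `0, …, k - 1` hold the one-hot encoding of the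
symbol (zero at the default position), coordinate `k` holds `i / n`, coordinate `k + 1` holds
`1 / (i + 2)^2`, where `i = p - 1` is the position, and all others hold `0`. -/
def Encoder.initial {A : Type*} {k k' : ℕ} (T : Encoder k k') (σ : Option A ≃ Fin k) {n : ℕ}
    (a : Fin n → Option A) : Act T.d n := fun p c =>
  let i : ℝ := (p.val : ℝ) - 1
  if c.val < k then
    Fin.cases (0 : ℝ) (fun t : Fin n => if (σ (a t)).val = c.val then 1 else 0) p
  else if c.val = k then i / n
  else if c.val = k + 1 then 1 / (i + 2) ^ 2
  else 0

/-- The final activation sequence. -/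
def Encoder.final {A : Type*} {k k' : ℕ} (T : Encoder k k') (σ : Option A ≃ Fin k) {n : ℕ}
    (a : Fin n → Option A) : Act T.d n :=
  T.layers.foldl (fun u L => L.apply u) (T.initial σ a)

/-- On the padded input vector `a`, the encoder outputs the padded vector `b`: the first `k'`
coordinates of the final activations hold the one-hot encoding of `b` (zero at the default
position). `σ` and `γ` are the orderings of the two alphabets. -/
def Encoder.Outputs {A B : Type*} {k k' : ℕ} (T : Encoder k k') (σ : Option A ≃ Fin k)
    (γ : Option B ≃ Fin k') (n : ℕ) (a : Fin n → Option A) (b : Fin n → Option B) : Prop :=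
  (∀ (i : Fin n) (c : Fin k'),
    T.final σ a i.succ (Fin.castLE T.output_le c) = if γ (b i) = c then 1 else 0) ∧
  ∀ c : Fin k', T.final σ a 0 (Fin.castLE T.output_le c) = 0

end AHAT

end

/-! Encoders can be run in parallel, in separate blocks of coordinates. Hence the features that are
linear functionals of the final activations of some encoder form a vector space. It is closed under
ReLU and under average-hard attention whose score is bilinear in such features.

Strict future masking tells the default position apart from the others, and averaging an indicator
of it yields the constants `1 / (n + 1) ^ m` and the feature `1 / (i + 2)`. On the integers `J ≥ 2`
the score `2 / J - X / J ^ 2` is maximal at `J = X`, so attention can read a value at a computed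
position. Reading the position itself turns the averages `(∑ j ≤ i, V j) / (i + 2)` into clipped
prefix sums.

For leftmost and rightmost attention, scores that are `0` where the predicate holds and at most
`-δ` elsewhere are perturbed by `± δ j / (4 n)`, and the default position gets the score `-δ / 2`,
so that it wins exactly when no position qualifies. Masks selecting later positions reduce to the
available ones by the reversal `i ↦ n - 1 - i`. Boolean expressions in two positions are
polynomials in `0`-`1` features of the single positions, hence bilinear scores. -/

noncomputable section

open Matrix
open scoped BigOperators

/-- A function of the input vector and of an index, for every length `n`. The index ranges over
the type `I n`: positions of activation sequences, positions of strings, tuples of positions. -/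
abbrev Feature (A : Type*) (I : ℕ → Type) : Type _ :=
  ∀ n : ℕ, (Fin n → Option A) → I n → ℝ

/-- Features of the positions of activation sequences. -/
abbrev ActFeature (A : Type*) : Type _ := Feature A fun n => Fin (n + 1)

namespace Feature

variable {A : Type*} {I J : ℕ → Type}

/-- Reindexing of features along maps of their index types. -/
def pullback (φ : ∀ n, I n → J n) : Feature A J →ₐ[ℝ] Feature A I where
  toFun f n a i := f n a (φ n i)
  map_one' := rfl
  map_mul' _ _ := rfl
  map_zero' := rfl
  map_add' _ _ := rfl
  commutes' _ := rfl

@[simp] lemma pullback_apply (φ : ∀ n, I n → J n) (f : Feature A J) (n : ℕ)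
    (a : Fin n → Option A) (i : I n) : pullback φ f n a i = f n a (φ n i) := rfl

/-- The span of the products `f i * g j` with `f ∈ U` and `g ∈ V`. -/
def outer (U V : Submodule ℝ (Feature A I)) : Submodule ℝ (Feature A fun n => I n × I n) :=
  U.map (pullback fun _ => Prod.fst).toLinearMap * V.map (pullback fun _ => Prod.snd).toLinearMap

variable {U V : Submodule ℝ (Feature A I)}

lemma outer_mono {U' V' : Submodule ℝ (Feature A I)} (hU : U ≤ U') (hV : V ≤ V') :
    outer U V ≤ outer U' V' :=
  mul_le_mul' (Submodule.map_mono hU) (Submodule.map_mono hV)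

lemma mul_mem_outer {f g : Feature A I} (hf : f ∈ U) (hg : g ∈ V) :
    (fun n a q => f n a q.1 * g n a q.2) ∈ outer U V :=
  Submodule.mul_mem_mul (Submodule.mem_map_of_mem hf) (Submodule.mem_map_of_mem hg)

lemma outer_induction {C : (Feature A fun n => I n × I n) → Prop}
    (mul : ∀ f ∈ U, ∀ g ∈ V, C fun n a q => f n a q.1 * g n a q.2)
    (add : ∀ S₁ S₂, C S₁ → C S₂ → C (S₁ + S₂)) {S : Feature A fun n => I n × I n}
    (hS : S ∈ outer U V) : C S := by
  refine Submodule.mul_induction_on hS ?_ add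
  rintro _ ⟨f, hf, rfl⟩ _ ⟨g, hg, rfl⟩
  exact mul f hf g hg

end Feature

namespace AHAT

open Feature

/-! ### Running encoders in parallel -/

/-- The layer acting as `L` on the image of the isometry `P` and trivially on its orthogonal
complement. -/
def Layer.conj {d d' : ℕ} (P : Matrix (Fin d') (Fin d) ℝ) : Layer d → Layer d'
  | .positionwise F => .positionwise
      { hidden := F.hidden
        W₁ := F.W₁ * Pᵀ
        b₁ := F.b₁
        W₂ := P * F.W₂
        b₂ := P *ᵥ F.b₂ }
  | .attention L => .attention
      { mask := L.mask
        Q := P.mulVecLin ∘ₗ L.Q ∘ₗ Pᵀ.mulVecLin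
        K := P.mulVecLin ∘ₗ L.K ∘ₗ Pᵀ.mulVecLin
        V := P.mulVecLin ∘ₗ L.V ∘ₗ Pᵀ.mulVecLin }

lemma dotProduct_mulVec_of_isometry {m n : Type*} [Fintype m] [Fintype n] [DecidableEq n]
    {P : Matrix m n ℝ} (hP : Pᵀ * P = 1) (x y : n → ℝ) : (P *ᵥ x) ⬝ᵥ (P *ᵥ y) = x ⬝ᵥ y := by
  rw [dotProduct_mulVec, ← mulVec_transpose, mulVec_mulVec, hP, one_mulVec]

lemma Layer.conj_apply {d d' n : ℕ} {P : Matrix (Fin d') (Fin d) ℝ} (hP : Pᵀ * P = 1)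
    (L : Layer d) (x : Act d n) {w : Act d' n} (hw : ∀ p, Pᵀ *ᵥ w p = 0) :
    (L.conj P).apply (fun p => P *ᵥ x p + w p) = fun p => P *ᵥ L.apply x p + w p := by
  have hproj (p : Fin (n + 1)) : Pᵀ *ᵥ (P *ᵥ x p + w p) = x p := by
    rw [mulVec_add, mulVec_mulVec, hP, one_mulVec, hw, add_zero]
  funext p
  cases L with
  | positionwise F =>
    simp only [Layer.conj, Layer.apply, FFN.apply, ← mulVec_mulVec, hproj]
    simp only [mulVec_add]
    abel
  | attention L =>
    have hscore : ∀ p r, Attn.score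
        { mask := L.mask
          Q := P.mulVecLin ∘ₗ L.Q ∘ₗ Pᵀ.mulVecLin
          K := P.mulVecLin ∘ₗ L.K ∘ₗ Pᵀ.mulVecLin
          V := P.mulVecLin ∘ₗ L.V ∘ₗ Pᵀ.mulVecLin } (fun p => P *ᵥ x p + w p) p r =
        L.score x p r := fun p r => by
      simp only [Attn.score, LinearMap.comp_apply, mulVecLin_apply, hproj,
        dotProduct_mulVec_of_isometry hP]
    simp only [Layer.conj, Layer.apply, Attn.maximizers, hscore, LinearMap.comp_apply,
      mulVecLin_apply, hproj, ← mulVec_sum, ← mulVec_smul, mulVec_add]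
    abel

lemma foldl_map_conj {d d' n : ℕ} {P : Matrix (Fin d') (Fin d) ℝ} (hP : Pᵀ * P = 1)
    (l : List (Layer d)) (x : Act d n) {w : Act d' n} (hw : ∀ p, Pᵀ *ᵥ w p = 0) :
    (l.map (Layer.conj P)).foldl (fun u L => L.apply u) (fun p => P *ᵥ x p + w p) =
      fun p => P *ᵥ l.foldl (fun u L => Layer.apply L u) x p + w p := by
  induction l generalizing x with
  | nil => rfl
  | cons L l ih => rw [List.map_cons, List.foldl_cons, L.conj_apply hP x hw, ih]; rfl

/-- A linear map as a feed-forward network, by `x = max 0 x - max 0 (-x)`. -/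
def FFN.linear {d : ℕ} (W : Matrix (Fin d) (Fin d) ℝ) : FFN d where
  hidden := d + d
  W₁ := Matrix.of (Fin.append W (-W))
  b₁ := 0
  W₂ := Matrix.of fun c => Fin.append (Pi.single c 1) (-Pi.single c 1)
  b₂ := 0

lemma FFN.linear_apply {d : ℕ} (W : Matrix (Fin d) (Fin d) ℝ) (x : Fin d → ℝ) :
    (FFN.linear W).apply x = W *ᵥ x := by
  have hrelu (y : ℝ) : max 0 y + -max 0 (-y) = y := by
    rw [max_comm, max_comm 0, ← sub_eq_add_neg]
    exact max_zero_sub_max_neg_zero_eq_self y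
  funext c
  rw [← hrelu ((W *ᵥ x) c)]
  change ∑ t : Fin (d + d), Fin.append (Pi.single c (1 : ℝ)) (-Pi.single c 1) t *
    max 0 (∑ e, Fin.append W (-W) t e * x e + 0) + 0 = _
  have hleft : ∀ t, Fin.append W (-W) (Fin.castAdd d t) = W t := Fin.append_left _ _
  have hright : ∀ t, Fin.append W (-W) (Fin.natAdd d t) = -W t := Fin.append_right _ _
  simp only [Fin.sum_univ_add, Fin.append_left, Fin.append_right, hleft, hright]
  simp [Matrix.mulVec, dotProduct, Pi.single_apply]

/-- The rectangular identity matrix: it truncates vectors or pads them with zeros. -/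
def resize (d' d : ℕ) : Matrix (Fin d') (Fin d) ℝ :=
  Matrix.of fun c' c => if c'.val = c.val then 1 else 0

lemma resize_mulVec {d' d : ℕ} (x : Fin d → ℝ) (c : Fin d') :
    (resize d' d *ᵥ x) c = if h : c.val < d then x ⟨c, h⟩ else 0 := by
  split_ifs with h
  · rw [mulVec, dotProduct, Finset.sum_eq_single ⟨c, h⟩] <;>
      simp +contextual [resize, Fin.ext_iff, eq_comm]
  · rw [mulVec, dotProduct]
    exact Finset.sum_eq_zero fun e _ => by
      rw [resize, of_apply, if_neg (by omega), zero_mul]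

namespace Encoder

variable {A : Type*} {k k₁ k₂ : ℕ}

lemma initial_eq_resize (T₁ : Encoder k k₁) (T₂ : Encoder k k₂) (σ : Option A ≃ Fin k) {n : ℕ}
    (a : Fin n → Option A) :
    T₂.initial σ a = fun p => resize T₂.d T₁.d *ᵥ T₁.initial σ a p := by
  funext p c
  have h₁ := T₁.input_le
  rw [resize_mulVec]
  split_ifs
  · rfl
  · simp only [initial]
    rw [if_neg (by omega), if_neg (by omega), if_neg (by omega)]

/-- The inclusion of the first block of coordinates. -/
abbrev inl (d₁ d₂ : ℕ) : Matrix (Fin (d₁ + d₂)) (Fin d₁) ℝ :=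
  (1 : Matrix _ _ ℝ).submatrix id (Fin.castAdd d₂)

/-- The inclusion of the second block of coordinates. -/
abbrev inr (d₁ d₂ : ℕ) : Matrix (Fin (d₁ + d₂)) (Fin d₂) ℝ :=
  (1 : Matrix _ _ ℝ).submatrix id (Fin.natAdd d₁)

lemma transpose_inl_mul_inl (d₁ d₂ : ℕ) : (inl d₁ d₂)ᵀ * inl d₁ d₂ = 1 := by
  ext; simp [Matrix.mul_apply, Matrix.one_apply]

lemma transpose_inr_mul_inr (d₁ d₂ : ℕ) : (inr d₁ d₂)ᵀ * inr d₁ d₂ = 1 := by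
  ext; simp [Matrix.mul_apply, Matrix.one_apply]

lemma transpose_inl_mul_inr (d₁ d₂ : ℕ) : (inl d₁ d₂)ᵀ * inr d₁ d₂ = 0 := by
  ext i j
  have := i.isLt
  simpa [Matrix.mul_apply, Matrix.one_apply, Fin.ext_iff] using
    Finset.sum_eq_zero fun x _ => ite_eq_right_iff.2 fun _ => if_neg (by omega)

lemma transpose_inr_mul_inl (d₁ d₂ : ℕ) : (inr d₁ d₂)ᵀ * inl d₁ d₂ = 0 := by
  rw [← transpose_inj, transpose_mul, transpose_transpose, transpose_inl_mul_inr, transpose_zero]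

/-- Both encoders at once, each in a block of coordinates of its own: the first layer copies the
input to the second block. The outputs are those of the second encoder, for the dimension. -/
abbrev parallel (T₁ : Encoder k k₁) (T₂ : Encoder k k₂) : Encoder k k₂ where
  d := T₁.d + T₂.d
  input_le := T₁.input_le.trans (Nat.le_add_right _ _)
  output_le := T₂.output_le.trans (Nat.le_add_left _ _)
  layers := .positionwise (.linear (inr T₁.d T₂.d * resize T₂.d T₁.d * (inl T₁.d T₂.d)ᵀ)) ::
    T₁.layers.map (.conj (inl T₁.d T₂.d)) ++ T₂.layers.map (.conj (inr T₁.d T₂.d))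

lemma parallel_initial (T₁ : Encoder k k₁) (T₂ : Encoder k k₂) (σ : Option A ≃ Fin k) {n : ℕ}
    (a : Fin n → Option A) :
    (T₁.parallel T₂).initial σ a = fun p => inl T₁.d T₂.d *ᵥ T₁.initial σ a p := by
  have hinl : inl T₁.d T₂.d = resize (T₁.d + T₂.d) T₁.d := by
    ext; simp [resize, Matrix.one_apply, Fin.ext_iff]
  rw [hinl]
  exact initial_eq_resize T₁ (T₁.parallel T₂) σ a

theorem parallel_final (T₁ : Encoder k k₁) (T₂ : Encoder k k₂) (σ : Option A ≃ Fin k) {n : ℕ}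
    (a : Fin n → Option A) :
    (T₁.parallel T₂).final σ a = fun p =>
      inl T₁.d T₂.d *ᵥ T₁.final σ a p + inr T₁.d T₂.d *ᵥ T₂.final σ a p := by
  have hcopy : (Layer.positionwise (.linear
      (inr T₁.d T₂.d * resize T₂.d T₁.d * (inl T₁.d T₂.d)ᵀ))).apply
        (fun p => inl T₁.d T₂.d *ᵥ T₁.initial σ a p) =
      fun p => inl T₁.d T₂.d *ᵥ T₁.initial σ a p + inr T₁.d T₂.d *ᵥ T₂.initial σ a p := by
    funext p
    simp only [Layer.apply, FFN.linear_apply]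
    rw [initial_eq_resize T₁ T₂, mulVec_mulVec, Matrix.mul_assoc, transpose_inl_mul_inl,
      Matrix.mul_one, ← mulVec_mulVec]
  rw [final, parallel_initial]
  simp only [parallel, List.cons_append, List.foldl_cons, List.foldl_append, hcopy]
  rw [foldl_map_conj (transpose_inl_mul_inl _ _) _ _ fun p => by
    rw [mulVec_mulVec, transpose_inl_mul_inr, zero_mulVec]]
  simp only [add_comm (inl T₁.d T₂.d *ᵥ _)]
  rw [foldl_map_conj (transpose_inr_mul_inr _ _) _ _ fun p => by
    rw [mulVec_mulVec, transpose_inr_mul_inl, zero_mulVec]]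
  rfl

/-- The features that are linear functionals of the final activations. -/
def span (T : Encoder k k₁) (σ : Option A ≃ Fin k) :
    Submodule ℝ (ActFeature A) :=
  Submodule.span ℝ (Set.range fun (c : Fin T.d) _ a p => T.final σ a p c)

lemma final_mem_span (T : Encoder k k₁) (σ : Option A ≃ Fin k) (c : Fin T.d) :
    (fun _ a p => T.final σ a p c) ∈ T.span σ :=
  Submodule.subset_span ⟨c, rfl⟩

lemma mem_span_iff {T : Encoder k k₁} {σ : Option A ≃ Fin k}
    {f : ActFeature A} :
    f ∈ T.span σ ↔ ∃ ℓ : Fin T.d → ℝ, ∀ n a p, f n a p = ℓ ⬝ᵥ T.final σ a p := by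
  simp only [span, Submodule.mem_span_range_iff_exists_fun, funext_iff, Finset.sum_apply,
    Pi.smul_apply, smul_eq_mul, dotProduct, eq_comm]

lemma span_le_span_of_final_eq {T₁ : Encoder k k₁} {T₂ : Encoder k k₂} {σ : Option A ≃ Fin k}
    (Λ : Matrix (Fin T₁.d) (Fin T₂.d) ℝ)
    (h : ∀ (n : ℕ) (a : Fin n → Option A) p, T₁.final σ a p = Λ *ᵥ T₂.final σ a p) :
    T₁.span σ ≤ T₂.span σ := by
  intro f hf
  obtain ⟨ℓ, hℓ⟩ := mem_span_iff.1 hf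
  exact mem_span_iff.2 ⟨ℓ ᵥ* Λ, fun n a p => by rw [hℓ, h, dotProduct_mulVec]⟩

lemma span_le_span_parallel_left (T₁ : Encoder k k₁) (T₂ : Encoder k k₂)
    (σ : Option A ≃ Fin k) : T₁.span σ ≤ (T₁.parallel T₂).span σ :=
  span_le_span_of_final_eq (inl T₁.d T₂.d)ᵀ fun n a p => by
    simp only [parallel_final, mulVec_add, mulVec_mulVec, transpose_inl_mul_inl,
      transpose_inl_mul_inr, one_mulVec, zero_mulVec, add_zero]

lemma span_le_span_parallel_right (T₁ : Encoder k k₁) (T₂ : Encoder k k₂)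
    (σ : Option A ≃ Fin k) : T₂.span σ ≤ (T₁.parallel T₂).span σ :=
  span_le_span_of_final_eq (inr T₁.d T₂.d)ᵀ fun n a p => by
    simp only [parallel_final, mulVec_add, mulVec_mulVec, transpose_inr_mul_inr,
      transpose_inr_mul_inl, one_mulVec, zero_mulVec, zero_add]

lemma directed_span (σ : Option A ≃ Fin k) :
    Directed (· ≤ ·) fun T : Encoder k k₁ => T.span σ := fun T₁ T₂ =>
  ⟨T₁.parallel T₂, span_le_span_parallel_left T₁ T₂ σ, span_le_span_parallel_right T₁ T₂ σ⟩

end Encoder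

/-! ### Computable features -/

lemma Encoder.exists_matrix_of_mem_outer {A : Type*} {k k' : ℕ} {σ : Option A ≃ Fin k}
    {T : Encoder k k'} {S : Feature A fun n => Fin (n + 1) × Fin (n + 1)}
    (hS : S ∈ outer (T.span σ) (T.span σ)) :
    ∃ W : Matrix (Fin T.d) (Fin T.d) ℝ, ∀ (n : ℕ) (a : Fin n → Option A) p r,
      S n a (p, r) = T.final σ a p ⬝ᵥ (W *ᵥ T.final σ a r) := by
  refine outer_induction (C := fun S => ∃ W : Matrix (Fin T.d) (Fin T.d) ℝ,
    ∀ (n : ℕ) (a : Fin n → Option A) p r, S n a (p, r) = T.final σ a p ⬝ᵥ (W *ᵥ T.final σ a r))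
    (fun f hf g hg => ?_) ?_ hS
  · obtain ⟨ℓ, hℓ⟩ := Encoder.mem_span_iff.1 hf
    obtain ⟨ℓ', hℓ'⟩ := Encoder.mem_span_iff.1 hg
    exact ⟨vecMulVec ℓ ℓ', fun n a p r => by
      simp only [hℓ, hℓ', vecMulVec_mulVec, op_smul_eq_smul, dotProduct_smul, smul_eq_mul,
        dotProduct_comm ℓ, mul_comm]⟩
  · rintro S₁ S₂ ⟨W₁, h₁⟩ ⟨W₂, h₂⟩
    exact ⟨W₁ + W₂, fun n a p r => by
      rw [Pi.add_apply, Pi.add_apply, Pi.add_apply, h₁, h₂, add_mulVec, dotProduct_add]⟩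

/-- The encoder `T` followed by the layer `L`. -/
abbrev Encoder.snoc {k k' : ℕ} (T : Encoder k k') (L : Layer T.d) : Encoder k k' :=
  { T with layers := T.layers ++ [L] }

lemma Encoder.snoc_final {A : Type*} {k k' : ℕ} (T : Encoder k k') (L : Layer T.d)
    (σ : Option A ≃ Fin k) {n : ℕ} (a : Fin n → Option A) :
    (T.snoc L).final σ a = L.apply (T.final σ a) := by
  simp only [Encoder.final, Encoder.snoc, List.foldl_append, List.foldl_cons, List.foldl_nil]
  rfl

/-- The encoder without layers, whose final activations are the initial ones. -/
def Encoder.base (k k' : ℕ) : Encoder k k' where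
  d := k + 2 + k'
  input_le := Nat.le_add_right _ _
  output_le := Nat.le_add_left _ _
  layers := []

/-- The features that are linear functionals of the final activations of some encoder. Encoders
with `k' = 0` suffice, as the outputs play no role here. -/
def computable {A : Type*} {k : ℕ} (σ : Option A ≃ Fin k) : Submodule ℝ (ActFeature A) :=
  ⨆ T : Encoder k 0, T.span σ

variable {A : Type*} {k : ℕ} {σ : Option A ≃ Fin k}

lemma exists_forall_mem_span {ι : Type*} [Finite ι] {f : ι → ActFeature A}
    (hf : ∀ t, f t ∈ computable σ) : ∃ T : Encoder k 0, ∀ t, f t ∈ T.span σ := by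
  have : Nonempty (Encoder k 0) := ⟨.base k 0⟩
  have hdir := Encoder.directed_span (k₁ := 0) σ
  choose T hT using fun t => (Submodule.mem_iSup_of_directed _ hdir).1 (hf t)
  obtain ⟨T', hT'⟩ := hdir.finite_le T
  exact ⟨T', fun t => hT' t (hT t)⟩

lemma mem_computable_iff {f : ActFeature A} :
    f ∈ computable σ ↔ ∃ T : Encoder k 0, f ∈ T.span σ :=
  ⟨fun hf => by simpa using exists_forall_mem_span (ι := Unit) fun _ => hf,
    fun ⟨T, hT⟩ => Submodule.mem_iSup_of_mem T hT⟩

lemma input_mem_computable (c : Fin k) :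
    (fun _ a p => Fin.cases (0 : ℝ) (fun t => if σ (a t) = c then 1 else 0) p) ∈
      computable σ := by
  refine mem_computable_iff.2 ⟨.base k 0, ?_⟩
  convert (Encoder.base k 0).final_mem_span σ ⟨c, by simp [Encoder.base]; omega⟩ using 4
  simp [Encoder.base, Encoder.final, Encoder.initial, Fin.ext_iff]

lemma pos_mem_computable :
    (fun n _ p => ((p : ℕ) - 1 : ℝ) / n : ActFeature A) ∈ computable σ := by
  refine mem_computable_iff.2 ⟨.base k 0, ?_⟩
  convert (Encoder.base k 0).final_mem_span σ ⟨k, by simp [Encoder.base]⟩ using 4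
  simp [Encoder.base, Encoder.final, Encoder.initial]

lemma inv_sq_mem_computable :
    (fun _ _ p => 1 / (((p : ℕ) : ℝ) - 1 + 2) ^ 2 : ActFeature A) ∈ computable σ := by
  refine mem_computable_iff.2 ⟨.base k 0, ?_⟩
  convert (Encoder.base k 0).final_mem_span σ ⟨k + 1, by simp [Encoder.base]⟩ using 4
  simp [Encoder.base, Encoder.final, Encoder.initial]

lemma mem_computable_of_layer (T : Encoder k 0) (L : Layer T.d) (c : Fin T.d) {f : ActFeature A}
    (hf : ∀ (n : ℕ) (a : Fin n → Option A) p,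
      L.apply (T.final σ a) p c = T.final σ a p c + f n a p) : f ∈ computable σ := by
  have hdiff : f = (fun _ a p => (T.snoc L).final σ a p c) - fun _ a p => T.final σ a p c := by
    funext n a p
    simp only [Pi.sub_apply, Encoder.snoc_final, hf, add_sub_cancel_left]
  rw [hdiff]
  exact sub_mem (mem_computable_iff.2 ⟨_, (T.snoc L).final_mem_span σ c⟩)
    (mem_computable_iff.2 ⟨_, T.final_mem_span σ c⟩)

lemma relu_add_const_mem_computable {f : ActFeature A} (hf : f ∈ computable σ) (b : ℝ) :
    (fun n a p => max 0 (f n a p + b)) ∈ computable σ := by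
  obtain ⟨T, hT⟩ := mem_computable_iff.1 hf
  obtain ⟨ℓ, hℓ⟩ := Encoder.mem_span_iff.1 hT
  refine mem_computable_of_layer T (.positionwise
    { hidden := 1
      W₁ := Matrix.of fun _ => ℓ
      b₁ := fun _ => b
      W₂ := Matrix.of fun _ _ => 1
      b₂ := 0 }) ⟨0, by have := T.input_le; omega⟩ fun n a p => ?_
  simp [Layer.apply, FFN.apply, hℓ, mulVec, dotProduct]

lemma one_mem_computable : (1 : ActFeature A) ∈ computable σ := by
  simpa using! relu_add_const_mem_computable (zero_mem (computable σ)) 1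

lemma relu_mem_computable {f : ActFeature A} (hf : f ∈ computable σ) :
    (fun n a p => max 0 (f n a p)) ∈ computable σ := by
  simpa using relu_add_const_mem_computable hf 0

/-- The allowed positions of maximal score. -/
def Mask.argmax {n : ℕ} (M : Mask) (p : Fin (n + 1)) (s : Fin (n + 1) → ℝ) :
    Finset (Fin (n + 1)) :=
  open Classical in (M.allowed p).filter fun r => ∀ r' ∈ M.allowed p, s r' ≤ s r

lemma exists_mem_outer_span {S : Feature A fun n => Fin (n + 1) × Fin (n + 1)}
    (hS : S ∈ outer (computable σ) (computable σ)) :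
    ∃ T : Encoder k 0, S ∈ outer (T.span σ) (T.span σ) := by
  refine outer_induction (C := fun S => ∃ T : Encoder k 0, S ∈ outer (T.span σ) (T.span σ))
    (fun f hf g hg => ?_) ?_ hS
  · obtain ⟨T, hT⟩ := exists_forall_mem_span (Bool.forall_bool.2 ⟨hf, hg⟩ : ∀ b, cond b g f ∈ _)
    exact ⟨T, mul_mem_outer (hT false) (hT true)⟩
  · rintro S₁ S₂ ⟨T₁, h₁⟩ ⟨T₂, h₂⟩
    obtain ⟨T, hle₁, hle₂⟩ := Encoder.directed_span σ T₁ T₂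
    exact ⟨T, add_mem (outer_mono hle₁ hle₁ h₁) (outer_mono hle₂ hle₂ h₂)⟩

lemma attention_mem_computable (M : Mask) {S : Feature A fun n => Fin (n + 1) × Fin (n + 1)}
    {v : ActFeature A} (hS : S ∈ outer (computable σ) (computable σ)) (hv : v ∈ computable σ) :
    (fun n a p => 𝔼 r ∈ M.argmax p fun r => S n a (p, r), v n a r) ∈ computable σ := by
  obtain ⟨T₁, hT₁⟩ := exists_mem_outer_span hS
  obtain ⟨T₂, hT₂⟩ := mem_computable_iff.1 hv
  obtain ⟨T, hle₁, hle₂⟩ := Encoder.directed_span σ T₁ T₂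
  obtain ⟨W, hW⟩ := Encoder.exists_matrix_of_mem_outer (outer_mono hle₁ hle₁ hT₁)
  obtain ⟨ℓ, hℓ⟩ := Encoder.mem_span_iff.1 (hle₂ hT₂)
  let c : Fin T.d := ⟨0, by have := T.input_le; omega⟩
  let L : Attn T.d :=
    { mask := M
      Q := LinearMap.id
      K := W.mulVecLin
      V := (vecMulVec (Pi.single c 1) ℓ).mulVecLin }
  have hL (n : ℕ) (a : Fin n → Option A) (p) :
      L.maximizers (T.final σ a) p = M.argmax p fun r => S n a (p, r) := by
    simp only [Attn.maximizers, Mask.argmax, hW]; rfl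
  refine mem_computable_of_layer T (.attention L) c fun n a p => ?_
  simp only [Layer.apply, hL, Finset.expect_eq_sum_div_card, hℓ]
  simp [L, vecMulVec_mulVec, div_eq_inv_mul]

theorem exists_encoder_of_forall_mem_computable {k' : ℕ} {f : Fin k' → ActFeature A}
    (hf : ∀ c, f c ∈ computable σ) :
    ∃ T : Encoder k k', ∀ (n : ℕ) (a : Fin n → Option A) p c,
      T.final σ a p (Fin.castLE T.output_le c) = f c n a p := by
  obtain ⟨T₀, hT₀⟩ := exists_forall_mem_span hf
  let T := T₀.parallel (.base k k')
  choose ℓ hℓ using fun c =>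
    Encoder.mem_span_iff.1 (Encoder.span_le_span_parallel_left T₀ (.base k k') σ (hT₀ c))
  let W : Matrix (Fin T.d) (Fin T.d) ℝ := Matrix.of fun e =>
    if h : e.val < k' then ℓ ⟨e, h⟩ - Pi.single e 1 else 0
  refine ⟨T.snoc (.positionwise (.linear W)), fun n a p c => ?_⟩
  have hrow : W (Fin.castLE T.output_le c) = ℓ c - Pi.single (Fin.castLE T.output_le c) 1 :=
    dif_pos c.isLt
  simp only [Encoder.snoc_final, Layer.apply, FFN.linear_apply, Pi.add_apply]
  rw [mulVec, hrow, sub_dotProduct, single_one_dotProduct, add_sub_cancel, hℓ]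

namespace Mask

variable {n : ℕ} {M : Mask} {p r : Fin (n + 1)}

@[simp] lemma mem_allowed_none : r ∈ Mask.none.allowed p := by simp [allowed]

@[simp] lemma mem_allowed_strictFuture : r ∈ Mask.strictFuture.allowed p ↔ r < p := by
  simp [allowed]

@[simp] lemma mem_allowed_future : r ∈ Mask.future.allowed p ↔ r ≤ p := by simp [allowed]

lemma zero_mem_allowed (M : Mask) (i : Fin n) : 0 ∈ M.allowed i.succ := by cases M <;> simp

lemma allowed_eq_empty (h : 0 ∉ M.allowed p) : M.allowed p = ∅ := by
  cases M <;> simp_all [allowed]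

lemma mem_argmax {s : Fin (n + 1) → ℝ} :
    r ∈ M.argmax p s ↔ r ∈ M.allowed p ∧ ∀ r' ∈ M.allowed p, s r' ≤ s r := by
  simp [argmax]

lemma argmax_const (c : ℝ) : M.argmax p (fun _ => c) = M.allowed p := by
  ext; simp [mem_argmax]

lemma expect_argmax_eq {s v : Fin (n + 1) → ℝ} {c : ℝ} (hne : (M.allowed p).Nonempty)
    (h : ∀ r ∈ M.argmax p s, v r = c) : 𝔼 r ∈ M.argmax p s, v r = c := by
  obtain ⟨r, hr⟩ := (M.allowed p).exists_max_image s hne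
  rw [Finset.expect_congr rfl h, Finset.expect_const ⟨r, mem_argmax.2 hr⟩]

end Mask

lemma expect_mem_computable (M : Mask) {f : ActFeature A} (hf : f ∈ computable σ) :
    (fun n a p => 𝔼 r ∈ M.allowed p, f n a r) ∈ computable σ := by
  simpa only [Pi.zero_apply, Mask.argmax_const] using attention_mem_computable M (zero_mem _) hf

lemma indicator_ne_zero_mem_computable :
    (fun _ _ p => if p = 0 then 0 else 1 : ActFeature A) ∈ computable σ := by
  convert expect_mem_computable .strictFuture one_mem_computable using 4 with n a p
  split_ifs with h
  · simp [h, Mask.allowed]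
  · exact (Finset.expect_const ⟨0, Mask.mem_allowed_strictFuture.2 (Fin.pos_of_ne_zero h)⟩ 1).symm

lemma indicator_eq_zero_mem_computable :
    (fun _ _ p => if p = 0 then 1 else 0 : ActFeature A) ∈ computable σ := by
  convert sub_mem one_mem_computable (indicator_ne_zero_mem_computable (σ := σ)) using 4
    with n a p
  by_cases h : p = 0 <;> simp [h]

lemma value_zero_mem_computable (M : Mask) {f : ActFeature A} (hf : f ∈ computable σ) :
    (fun n a p => if 0 ∈ M.allowed p then f n a 0 else 0) ∈ computable σ := by
  convert attention_mem_computable M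
    (mul_mem_outer one_mem_computable indicator_eq_zero_mem_computable) hf using 4 with n a p
  split_ifs with h
  · refine (Mask.expect_argmax_eq ⟨0, h⟩ fun r hr => ?_).symm
    by_contra hne
    have hr0 : r ≠ 0 := fun h0 => hne (h0 ▸ rfl)
    have hle := (Mask.mem_argmax.1 hr).2 0 h
    norm_num [hr0] at hle
  · simp [Mask.argmax, Mask.allowed_eq_empty h]

lemma restrict_mem_computable {f : ActFeature A} (hf : f ∈ computable σ) :
    (fun n a p => if p = 0 then 0 else f n a p) ∈ computable σ := by
  convert add_mem (sub_mem hf (value_zero_mem_computable .none hf))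
    (value_zero_mem_computable .strictFuture hf) using 4 with n a p
  by_cases h : p = 0 <;> simp [h, Fin.pos_iff_ne_zero]

lemma const_at_zero_mem_computable {z : ℕ → ℝ}
    (hz : (fun n _ _ => z n : ActFeature A) ∈ computable σ) :
    (fun n _ p => if p = 0 then z n else 0 : ActFeature A) ∈ computable σ := by
  convert sub_mem hz (restrict_mem_computable hz) using 4 with n a p
  by_cases h : p = 0 <;> simp [h]

lemma div_succ_length_mem_computable {z : ℕ → ℝ}
    (hz : (fun n _ _ => z n : ActFeature A) ∈ computable σ) :
    (fun n _ _ => z n / (n + 1) : ActFeature A) ∈ computable σ := by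
  convert expect_mem_computable .none (const_at_zero_mem_computable hz) using 4 with n _ p
  simp [Mask.allowed, Finset.expect_eq_sum_div_card]

lemma inv_succ_length_pow_mem_computable (m : ℕ) :
    (fun n _ _ => 1 / ((n : ℝ) + 1) ^ m : ActFeature A) ∈ computable σ := by
  induction m with
  | zero => simpa using! one_mem_computable
  | succ m ih => simpa only [pow_succ, div_div] using div_succ_length_mem_computable ih

lemma inv_length_mem_computable : (fun n _ _ => 1 / (n : ℝ) : ActFeature A) ∈ computable σ := by
  convert neg_mem (value_zero_mem_computable .none (pos_mem_computable (σ := σ))) using 4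
  simp [neg_div]

/-! ### Features of string positions -/

/-- The restrictions of computable features to the string positions. -/
def stringComputable (σ : Option A ≃ Fin k) : Submodule ℝ (Feature A Fin) :=
  (computable σ).map (pullback fun _ => Fin.succ).toLinearMap

lemma mem_stringComputable_of_succ {f : ActFeature A} {g : Feature A Fin} (hf : f ∈ computable σ)
    (h : ∀ n a i, g n a i = f n a i.succ) : g ∈ stringComputable σ :=
  ⟨f, hf, by funext n a i; exact (h n a i).symm⟩

lemma exists_extension_of_mem_stringComputable {g : Feature A Fin}
    (hg : g ∈ stringComputable σ) :
    ∃ f ∈ computable σ, ∀ n a, f n a 0 = 0 ∧ ∀ i : Fin n, f n a i.succ = g n a i := by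
  obtain ⟨f, hf, rfl⟩ := hg
  exact ⟨_, restrict_mem_computable hf, fun n a => by simp⟩

lemma exists_extension_of_mem_outer {S : Feature A fun n => Fin n × Fin n}
    (hS : S ∈ outer (stringComputable σ) (stringComputable σ)) :
    ∃ S' ∈ outer (computable σ) (computable σ), ∀ n a, (∀ p, S' n a (p, 0) = 0) ∧
      ∀ i j : Fin n, S' n a (i.succ, j.succ) = S n a (i, j) := by
  refine outer_induction (C := fun S => ∃ S' ∈ outer (computable σ) (computable σ),
    ∀ n a, (∀ p, S' n a (p, 0) = 0) ∧
      ∀ i j : Fin n, S' n a (i.succ, j.succ) = S n a (i, j)) (fun f hf g hg => ?_) ?_ hS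
  · obtain ⟨f', hf', hf⟩ := exists_extension_of_mem_stringComputable hf
    obtain ⟨g', hg', hg⟩ := exists_extension_of_mem_stringComputable hg
    exact ⟨_, mul_mem_outer hf' hg', fun n a => by simp [hf, hg]⟩
  · rintro S₁ S₂ ⟨S₁', h₁, hS₁⟩ ⟨S₂', h₂, hS₂⟩
    exact ⟨_, add_mem h₁ h₂, fun n a => by simp [hS₁, hS₂]⟩

lemma one_mem_stringComputable : (1 : Feature A Fin) ∈ stringComputable σ :=
  mem_stringComputable_of_succ one_mem_computable fun _ _ _ => rfl

lemma input_mem_stringComputable (c : Fin k) :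
    (fun _ a i => if σ (a i) = c then 1 else 0 : Feature A Fin) ∈ stringComputable σ :=
  mem_stringComputable_of_succ (input_mem_computable c) fun _ _ _ => rfl

lemma pos_mem_stringComputable :
    (fun n _ i => (i : ℕ) / n : Feature A Fin) ∈ stringComputable σ :=
  mem_stringComputable_of_succ pos_mem_computable fun _ _ _ => by simp

lemma inv_sq_mem_stringComputable :
    (fun _ _ i => 1 / (((i : ℕ) : ℝ) + 2) ^ 2 : Feature A Fin) ∈ stringComputable σ :=
  mem_stringComputable_of_succ inv_sq_mem_computable fun _ _ _ => by simp

lemma inv_length_mem_stringComputable :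
    (fun n _ _ => 1 / (n : ℝ) : Feature A Fin) ∈ stringComputable σ :=
  mem_stringComputable_of_succ inv_length_mem_computable fun _ _ _ => rfl

lemma inv_succ_length_pow_mem_stringComputable (m : ℕ) :
    (fun n _ _ => 1 / ((n : ℝ) + 1) ^ m : Feature A Fin) ∈ stringComputable σ :=
  mem_stringComputable_of_succ (inv_succ_length_pow_mem_computable m) fun _ _ _ => rfl

lemma relu_mem_stringComputable {g : Feature A Fin} (hg : g ∈ stringComputable σ) :
    (fun n a i => max 0 (g n a i)) ∈ stringComputable σ := by
  obtain ⟨f, hf, rfl⟩ := hg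
  exact mem_stringComputable_of_succ (relu_mem_computable hf) fun _ _ _ => rfl

lemma min_mem_stringComputable {g h : Feature A Fin} (hg : g ∈ stringComputable σ)
    (hh : h ∈ stringComputable σ) :
    (fun n a i => min (g n a i) (h n a i)) ∈ stringComputable σ := by
  convert sub_mem hg (relu_mem_stringComputable (sub_mem hg hh)) using 4 with n a i
  rcases le_total (g n a i) (h n a i) with hle | hle <;> simp [hle]

lemma prefix_sum_div_mem_stringComputable {z : ℕ → ℝ} {g : Feature A Fin}
    (hz : (fun n _ _ => z n : ActFeature A) ∈ computable σ) (hg : g ∈ stringComputable σ) :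
    (fun n a i => (z n + ∑ j ≤ i, g n a j) / ((i : ℕ) + 2)) ∈ stringComputable σ := by
  obtain ⟨f, hf, hfg⟩ := exists_extension_of_mem_stringComputable hg
  refine mem_stringComputable_of_succ
    (expect_mem_computable .future (add_mem hf (const_at_zero_mem_computable hz))) fun n a i => ?_
  have hIic : Mask.future.allowed i.succ = Finset.Iic i.succ := by ext; simp
  have hsum : ∀ u : Fin (n + 1) → ℝ, ∑ r ≤ i.succ, u r = u 0 + ∑ j ≤ i, u j.succ := fun u => by
    simp only [← Finset.filter_ge_eq_Iic, Finset.sum_filter, Fin.sum_univ_succ]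
    simp
  rw [hIic, Finset.expect_eq_sum_div_card, hsum, Fin.card_Iic]
  simp [hfg, add_assoc, one_add_one_eq_two]

lemma inv_pos_mem_stringComputable :
    (fun _ _ i => 1 / (((i : ℕ) : ℝ) + 2) : Feature A Fin) ∈ stringComputable σ := by
  simpa using! prefix_sum_div_mem_stringComputable (z := 1) one_mem_computable (zero_mem _)

/-- The default position is given the score `θ`. -/
lemma select_mem_stringComputable (M : Mask) {S : Feature A fun n => Fin n × Fin n}
    {θ v g : Feature A Fin} (hS : S ∈ outer (stringComputable σ) (stringComputable σ))
    (hθ : θ ∈ stringComputable σ) (hv : v ∈ stringComputable σ)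
    (h : ∀ n a i,
      (∃ j : Fin n, j.succ ∈ M.allowed i.succ ∧ θ n a i < S n a (i, j) ∧
        ∀ j : Fin n, j.succ ∈ M.allowed i.succ →
          (∀ j' : Fin n, j'.succ ∈ M.allowed i.succ → S n a (i, j') ≤ S n a (i, j)) →
            v n a j = g n a i) ∨
      ((∀ j : Fin n, j.succ ∈ M.allowed i.succ → S n a (i, j) < θ n a i) ∧ g n a i = 0)) :
    g ∈ stringComputable σ := by
  obtain ⟨S', hS', hSS'⟩ := exists_extension_of_mem_outer hS
  obtain ⟨θ', hθ', hθθ'⟩ := exists_extension_of_mem_stringComputable hθ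
  obtain ⟨v', hv', hvv'⟩ := exists_extension_of_mem_stringComputable hv
  refine mem_stringComputable_of_succ (attention_mem_computable M
    (add_mem hS' (mul_mem_outer hθ' indicator_eq_zero_mem_computable)) hv') fun n a i => ?_
  refine (Mask.expect_argmax_eq ⟨0, M.zero_mem_allowed i⟩ fun r hr => ?_).symm
  obtain ⟨hallowed, hmax⟩ := Mask.mem_argmax.1 hr
  simp only [Pi.add_apply] at hmax
  rcases h n a i with ⟨j, hj, hθS, hval⟩ | ⟨hlt, h0⟩ <;>
    obtain rfl | ⟨r, rfl⟩ := Fin.eq_zero_or_eq_succ r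
  · refine absurd (hmax _ hj) (not_le.2 ?_)
    simpa [hSS', hθθ'] using hθS
  · rw [(hvv' n a).2]
    refine hval r hallowed fun j' hj' => ?_
    simpa [hSS'] using hmax _ hj'
  · rw [h0, (hvv' n a).1]
  · refine absurd (hmax 0 (M.zero_mem_allowed i)) (not_le.2 ?_)
    simpa [hSS', hθθ'] using hlt r hallowed

lemma isPos_mem_stringComputable {g : Feature A Fin} (hg : g ∈ stringComputable σ)
    (h0 : ∀ n a i, g n a i ≠ 0) :
    (fun n a i => if 0 < g n a i then 1 else 0 : Feature A Fin) ∈ stringComputable σ := by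
  refine select_mem_stringComputable .none (mul_mem_outer hg one_mem_stringComputable)
    (zero_mem _) one_mem_stringComputable fun n a i => ?_
  by_cases hpos : 0 < g n a i
  · exact Or.inl ⟨i, by simp [hpos]⟩
  · exact Or.inr (by simp [hpos, lt_of_le_of_ne (not_lt.1 hpos) (h0 n a i)])

/-- On the integers `M` up to some bound, `2 / M - X / M ^ 2` is maximal at the one closest to
`X`, which may exceed the bound. -/
lemma two_div_sub_div_sq_lt {X J M : ℝ} (hJ : 0 < J) (hM : 0 < M)
    (h : J < M ∧ M ≤ X ∨ J ≠ M ∧ M = X) :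
    2 / J - X / J ^ 2 < 2 / M - X / M ^ 2 := by
  have hdiff : 2 / M - X / M ^ 2 - (2 / J - X / J ^ 2) =
      (M - J) * (X * (J + M) - 2 * J * M) / (J * M) ^ 2 := by
    field_simp
    ring
  have hnum : 0 < (M - J) * (X * (J + M) - 2 * J * M) := by
    rcases h with ⟨hlt, hle⟩ | ⟨hne, rfl⟩
    · exact mul_pos (sub_pos.2 hlt) (by nlinarith)
    · have : M - J ≠ 0 := sub_ne_zero.2 hne.symm
      have hsq : 0 < M * (M - J) ^ 2 := by positivity
      linarith
  rw [← sub_pos, hdiff]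
  positivity

lemma clip_lt {n : ℕ} (i : Fin n) (x : ℕ) : SRASP.clip n x < n := by
  have := i.pos
  unfold SRASP.clip
  omega

/-- The position is given only up to a positive factor `l`. -/
lemma lookup_clip_mem_stringComputable {l v : Feature A Fin}
    {x : ∀ n, (Fin n → Option A) → Fin n → ℕ} (hl : l ∈ stringComputable σ)
    (hpos : ∀ n a i, 0 < l n a i)
    (hx : (fun n a i => l n a i * (x n a i + 2)) ∈ stringComputable σ)
    (hv : v ∈ stringComputable σ) :
    (fun n a i => v n a ⟨SRASP.clip n (x n a i), clip_lt i _⟩) ∈ stringComputable σ := by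
  refine select_mem_stringComputable .none
    (sub_mem (Submodule.smul_mem _ 2 (mul_mem_outer hl inv_pos_mem_stringComputable))
      (mul_mem_outer hx inv_sq_mem_stringComputable)) (neg_mem hx) hv fun n a i => Or.inl ?_
  obtain ⟨m, hm⟩ : ∃ m : Fin n, m = ⟨SRASP.clip n (x n a i), clip_lt i _⟩ := ⟨_, rfl⟩
  have hm' : m.val = min (x n a i) (n - 1) := congrArg Fin.val hm
  have hln := hpos n a i
  have hscore : ∀ j : Fin n, 2 * (l n a i * (1 / ((j : ℕ) + 2))) -
      l n a i * (x n a i + 2) * (1 / ((j : ℕ) + 2) ^ 2) =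
        l n a i * (2 / ((j : ℕ) + 2) - (x n a i + 2) / ((j : ℕ) + 2) ^ 2) := fun j => by ring
  rw [← hm]
  refine ⟨m, by simp, ?_, fun j _ hj => ?_⟩
  · change -(l n a i * (x n a i + 2)) < 2 * (l n a i * (1 / ((m : ℕ) + 2))) -
      l n a i * (x n a i + 2) * (1 / ((m : ℕ) + 2) ^ 2)
    have hle : 1 / ((m : ℝ) + 2) ^ 2 ≤ 1 := by
      rw [div_le_one (by positivity)]
      nlinarith [(Nat.cast_nonneg m.val : (0 : ℝ) ≤ m.val)]
    have hfirst : 0 < 2 * (l n a i * (1 / ((m : ℝ) + 2))) := by positivity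
    have hsecond := mul_le_mul_of_nonneg_left hle (a := l n a i * (x n a i + 2)) (by positivity)
    linarith
  · suffices hjm : j = m by rw [hjm]
    by_contra hne
    have hne' : j.val ≠ m.val := fun h => hne (Fin.ext h)
    refine absurd (hj m (by simp)) (not_le.2 ?_)
    change 2 * (l n a i * (1 / ((j : ℕ) + 2))) - l n a i * (x n a i + 2) * (1 / ((j : ℕ) + 2) ^ 2) <
      2 * (l n a i * (1 / ((m : ℕ) + 2))) - l n a i * (x n a i + 2) * (1 / ((m : ℕ) + 2) ^ 2)
    rw [hscore, hscore]
    refine mul_lt_mul_of_pos_left (two_div_sub_div_sq_lt (by positivity) (by positivity) ?_) hln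
    have hcases : j.val < m.val ∧ m.val ≤ x n a i ∨ j.val ≠ m.val ∧ m.val = x n a i := by omega
    exact_mod_cast hcases.imp (And.imp (Nat.add_lt_add_right · 2) (Nat.add_le_add_right · 2))
      (And.imp (mt Nat.add_right_cancel) (congrArg (· + 2)))

lemma lookup_mem_stringComputable {x : ∀ n, (Fin n → Option A) → Fin n → Fin n}
    {g : Feature A Fin}
    (hx : (fun n a i => ((x n a i : ℕ) : ℝ) / n) ∈ stringComputable σ)
    (hg : g ∈ stringComputable σ) : (fun n a i => g n a (x n a i)) ∈ stringComputable σ := by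
  have hclip : ∀ n a (i : Fin n), x n a i = ⟨SRASP.clip n (x n a i), clip_lt i _⟩ :=
    fun n a i => Fin.ext (min_eq_left (by omega)).symm
  rw [show (fun n a i => g n a (x n a i)) =
    fun n a i => g n a ⟨SRASP.clip n (x n a i), clip_lt i _⟩ by simp only [← hclip]]
  refine lookup_clip_mem_stringComputable (x := fun n a i => x n a i)
    inv_length_mem_stringComputable (fun n _ i => ?_) ?_ hg
  · have : (0 : ℝ) < n := by exact_mod_cast i.pos
    positivity
  · convert add_mem hx (Submodule.smul_mem _ 2 inv_length_mem_stringComputable) using 4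
    simp only [Pi.add_apply, Pi.smul_apply, smul_eq_mul]
    ring

lemma clip_sum_mem_stringComputable {V : ∀ n, (Fin n → Option A) → Fin n → ℕ}
    (hV : (fun n a i => (V n a i : ℝ) / n) ∈ stringComputable σ) :
    (fun n a i => (SRASP.clip n (∑ j ≤ i, V n a j) : ℝ) / n) ∈ stringComputable σ := by
  refine lookup_clip_mem_stringComputable (x := fun n a i => ∑ j ≤ i, V n a j)
    (prefix_sum_div_mem_stringComputable inv_length_mem_computable (zero_mem _))
    (fun n a i => ?_) ?_ pos_mem_stringComputable
  · have : (0 : ℝ) < n := by exact_mod_cast i.pos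
    simp only [Pi.zero_apply, Finset.sum_const_zero, add_zero]
    positivity
  · convert prefix_sum_div_mem_stringComputable (z := fun n => 2 * (1 / n))
      (Submodule.smul_mem _ 2 inv_length_mem_computable) hV using 4 with n a i
    simp only [← Finset.sum_div, Pi.zero_apply, Finset.sum_const_zero]
    push_cast
    ring

/-! ### Leftmost and rightmost attention -/

/-- A predicate of two positions that attention scores can separate from its negation, with a
margin `δ` that may depend on the attending position. -/
def Attendable (σ : Option A ≃ Fin k) (P : ∀ n, (Fin n → Option A) → Fin n → Fin n → Prop) :
    Prop :=
  ∃ S ∈ outer (stringComputable σ) (stringComputable σ), ∃ δ ∈ stringComputable σ,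
    ∀ n a i, 0 < δ n a i ∧
      ∀ j, (P n a i j → S n a (i, j) = 0) ∧ (¬P n a i j → S n a (i, j) ≤ -δ n a i)

/-- `j` is the leftmost, respectively rightmost, element of `s`. -/
def IsChoice {n : ℕ} : SRASP.Choice → Set (Fin n) → Fin n → Prop
  | .leftmost, s, j => IsLeast s j
  | .rightmost, s, j => IsGreatest s j

/-- `y` is the result of attending to the chosen element of `s`, with values `v` and default
value `d`. -/
def IsAttnValue {n : ℕ} {α : Type*} (c : SRASP.Choice) (s : Set (Fin n)) (v : Fin n → α)
    (d y : α) : Prop :=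
  (∃ j, IsChoice c s j ∧ y = v j) ∨ s = ∅ ∧ y = d

lemma IsChoice.mem {n : ℕ} {c : SRASP.Choice} {s : Set (Fin n)} {j : Fin n}
    (h : IsChoice c s j) : j ∈ s := by
  cases c <;> exact h.1

lemma IsAttnValue.map {n : ℕ} {α β : Type*} {c : SRASP.Choice} {s : Set (Fin n)}
    {v : Fin n → α} {d y : α} (h : IsAttnValue c s v d y) (f : α → β) :
    IsAttnValue c s (fun j => f (v j)) (f d) (f y) :=
  h.imp (fun ⟨j, hj, hy⟩ => ⟨j, hj, congrArg f hy⟩) (And.imp_right (congrArg f))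

/-- The sign with which positions enter the scores, so that the chosen one scores highest. -/
def choiceSign : SRASP.Choice → ℝ
  | .leftmost => -1
  | .rightmost => 1

lemma abs_choiceSign (c : SRASP.Choice) : |choiceSign c| = 1 := by cases c <;> simp [choiceSign]

lemma IsChoice.eq_of_choiceSign_mul_le {n : ℕ} {c : SRASP.Choice} {s : Set (Fin n)}
    {j j' : Fin n} (h : IsChoice c s j) (hj' : j' ∈ s)
    (hle : choiceSign c * (j : ℕ) ≤ choiceSign c * (j' : ℕ)) : j' = j := by
  cases c with
  | leftmost =>
    refine le_antisymm (Fin.le_def.2 ?_) (h.2 hj')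
    simpa [choiceSign] using hle
  | rightmost =>
    refine le_antisymm (h.2 hj') (Fin.le_def.2 ?_)
    simpa [choiceSign] using hle

lemma abs_choiceSign_div_mul_le (c : SRASP.Choice) {δ : ℝ} (hδ : 0 < δ) {n : ℕ} (j : Fin n) :
    |choiceSign c / 4 * (δ * ((j : ℕ) / n))| ≤ δ / 4 := by
  have hfrac : ((j : ℕ) / n : ℝ) ≤ 1 :=
    div_le_one_of_le₀ (by exact_mod_cast j.isLt.le) (Nat.cast_nonneg n)
  have hmul := mul_le_mul_of_nonneg_left hfrac hδ.le
  rw [abs_mul, abs_div, abs_choiceSign, abs_of_nonneg (by positivity : 0 ≤ δ * ((j : ℕ) / n)),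
    Nat.abs_ofNat]
  linarith

variable {P : ∀ n, (Fin n → Option A) → Fin n → Fin n → Prop}

/-- Ties are broken by perturbing the scores by at most a quarter of the margin; positions that
do not satisfy `P` stay below the default position, which gets half of the margin. -/
lemma Attendable.isAttnValue_allowed_mem_stringComputable (hP : Attendable σ P)
    (c : SRASP.Choice) (M : Mask) {v g : Feature A Fin} (hv : v ∈ stringComputable σ)
    (hg : ∀ n a i, IsAttnValue c {j | j.succ ∈ M.allowed i.succ ∧ P n a i j} (v n a) 0
      (g n a i)) : g ∈ stringComputable σ := by
  obtain ⟨S, hS, δ, hδ, hSδ⟩ := hP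
  refine select_mem_stringComputable M
    (add_mem hS (Submodule.smul_mem _ (choiceSign c / 4)
      (mul_mem_outer hδ pos_mem_stringComputable)))
    (Submodule.smul_mem _ (-1 / 2) hδ) hv fun n a i => ?_
  obtain ⟨hpos, hsep⟩ := hSδ n a i
  let t (j : Fin n) : ℝ := choiceSign c / 4 * (δ n a i * ((j : ℕ) / n))
  have ht (j : Fin n) : -(δ n a i / 4) ≤ t j ∧ t j ≤ δ n a i / 4 :=
    abs_le.1 (abs_choiceSign_div_mul_le c hpos j)
  change (∃ j : Fin n, _ ∧ -1 / 2 * δ n a i < S n a (i, j) + t j ∧ ∀ j' : Fin n, _ →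
      (∀ j'' : Fin n, _ → S n a (i, j'') + t j'' ≤ S n a (i, j') + t j') → _) ∨
    (∀ j : Fin n, _ → S n a (i, j) + t j < -1 / 2 * δ n a i) ∧ _
  rcases hg n a i with ⟨j, hj, hgj⟩ | ⟨hempty, hg0⟩
  · obtain ⟨hallowed, hPj⟩ := hj.mem
    have hSj := (hsep j).1 hPj
    refine Or.inl ⟨j, hallowed, by linarith [ht j], fun j' hallowed' hmax => ?_⟩
    have hle := hmax j hallowed
    have hPj' : P n a i j' := by
      by_contra hnot
      linarith [(hsep j').2 hnot, ht j, ht j']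
    rw [hSj, (hsep j').1 hPj', zero_add, zero_add] at hle
    rw [hgj, hj.eq_of_choiceSign_mul_le ⟨hallowed', hPj'⟩]
    have hn : (0 : ℝ) < n := by exact_mod_cast i.pos
    have hscale : 0 < δ n a i / (4 * n) := by positivity
    refine le_of_mul_le_mul_left ?_ hscale
    have hscaled (j : Fin n) : δ n a i / (4 * n) * (choiceSign c * (j : ℕ)) = t j := by
      simp only [t]
      ring
    rwa [hscaled, hscaled]
  · refine Or.inr ⟨fun j hj => ?_, hg0⟩
    have hnot : ¬P n a i j := fun hPj => hempty.subset ⟨hj, hPj⟩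
    linarith [(hsep j).2 hnot, ht j]

/-! ### Reversal -/

lemma rev_mem_stringComputable {g : Feature A Fin} (hg : g ∈ stringComputable σ) :
    (fun n a i => g n a i.rev) ∈ stringComputable σ := by
  refine lookup_mem_stringComputable (x := fun _ _ i => i.rev) ?_ hg
  convert sub_mem (sub_mem one_mem_stringComputable inv_length_mem_stringComputable)
    pos_mem_stringComputable using 4 with n a i
  have : (n : ℝ) ≠ 0 := by exact_mod_cast i.pos.ne'
  simp only [Pi.sub_apply, Pi.one_apply]
  rw [Fin.val_rev, Nat.cast_sub (by omega)]
  push_cast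
  field_simp
  ring

lemma rev_mem_outer {S : Feature A fun n => Fin n × Fin n}
    (hS : S ∈ outer (stringComputable σ) (stringComputable σ)) :
    (fun n a q => S n a (q.1.rev, q.2.rev)) ∈
      outer (stringComputable σ) (stringComputable σ) := by
  refine outer_induction (C := fun S => (fun n a q => S n a (q.1.rev, q.2.rev)) ∈
    outer (stringComputable σ) (stringComputable σ)) (fun f hf g hg => ?_) ?_ hS
  · exact mul_mem_outer (rev_mem_stringComputable hf) (rev_mem_stringComputable hg)
  · exact fun _ _ h₁ h₂ => add_mem h₁ h₂

lemma Attendable.rev (hP : Attendable σ P) :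
    Attendable σ fun n a i j => P n a i.rev j.rev := by
  obtain ⟨S, hS, δ, hδ, h⟩ := hP
  exact ⟨_, rev_mem_outer hS, _, rev_mem_stringComputable hδ, fun n a i =>
    ⟨(h n a i.rev).1, fun j => (h n a i.rev).2 j.rev⟩⟩

/-- Leftmost instead of rightmost, and conversely. -/
def opposite : SRASP.Choice → SRASP.Choice
  | .leftmost => .rightmost
  | .rightmost => .leftmost

lemma IsChoice.rev {n : ℕ} {c : SRASP.Choice} {s : Set (Fin n)} {j : Fin n}
    (h : IsChoice c s j) : IsChoice (opposite c) (Fin.rev ⁻¹' s) j.rev := by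
  cases c <;>
    exact ⟨by simpa using h.1, fun j' hj' => by simpa using Fin.rev_le_rev.2 (h.2 hj')⟩

lemma IsAttnValue.rev {n : ℕ} {α : Type*} {c : SRASP.Choice} {s : Set (Fin n)} {v : Fin n → α}
    {d y : α} (h : IsAttnValue c s v d y) :
    IsAttnValue (opposite c) (Fin.rev ⁻¹' s) (fun j => v j.rev) d y :=
  h.imp (fun ⟨j, hj, hy⟩ => ⟨j.rev, hj.rev, by simpa using hy⟩)
    (And.imp_left fun hs => by rw [hs, Set.preimage_empty])

lemma Attendable.isAttnValue_zero_mem_stringComputable (hP : Attendable σ P) (c : SRASP.Choice)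
    (M : SRASP.Mask) {v g : Feature A Fin} (hv : v ∈ stringComputable σ)
    (hg : ∀ n a i, IsAttnValue c {j | M.test i j = true ∧ P n a i j} (v n a) 0 (g n a i)) :
    g ∈ stringComputable σ := by
  have of_rev (h : (fun n a i => g n a i.rev) ∈ stringComputable σ) : g ∈ stringComputable σ := by
    simpa only [Fin.rev_rev] using rev_mem_stringComputable h
  cases M with
  | none =>
    refine hP.isAttnValue_allowed_mem_stringComputable c .none hv fun n a i => ?_
    simpa [SRASP.Mask.test] using hg n a i
  | lt =>
    refine hP.isAttnValue_allowed_mem_stringComputable c .strictFuture hv fun n a i => ?_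
    simpa [SRASP.Mask.test] using hg n a i
  | le =>
    refine hP.isAttnValue_allowed_mem_stringComputable c .future hv fun n a i => ?_
    simpa [SRASP.Mask.test] using hg n a i
  | gt =>
    refine of_rev (hP.rev.isAttnValue_allowed_mem_stringComputable (opposite c) .strictFuture
      (rev_mem_stringComputable hv) fun n a i => ?_)
    simpa [SRASP.Mask.test, Set.preimage] using (hg n a i.rev).rev
  | ge =>
    refine of_rev (hP.rev.isAttnValue_allowed_mem_stringComputable (opposite c) .future
      (rev_mem_stringComputable hv) fun n a i => ?_)
    simpa [SRASP.Mask.test, Set.preimage] using (hg n a i.rev).rev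

/-- The attention that outputs `1`, with default `0`, detects whether some position qualifies. -/
lemma Attendable.isAttnValue_mem_stringComputable (hP : Attendable σ P) (c : SRASP.Choice)
    (M : SRASP.Mask) {v d g : Feature A Fin} (hv : v ∈ stringComputable σ)
    (hd : d ∈ stringComputable σ) (hd01 : ∀ n a i, d n a i ∈ Set.Icc 0 1)
    (hg : ∀ n a i, IsAttnValue c {j | M.test i j = true ∧ P n a i j} (v n a) (d n a i)
      (g n a i)) : g ∈ stringComputable σ := by
  classical
  let E (n) (a : Fin n → Option A) (i : Fin n) : Prop := ∃ j, M.test i j = true ∧ P n a i j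
  have hcases (n a i) : (E n a i ∧ ∃ j, IsChoice c {j | M.test i j = true ∧ P n a i j} j ∧
      g n a i = v n a j) ∨ ({j | M.test i j = true ∧ P n a i j} = ∅ ∧ ¬E n a i ∧
        g n a i = d n a i) :=
    (hg n a i).imp (fun ⟨j, hj, hgj⟩ => ⟨⟨j, hj.mem⟩, j, hj, hgj⟩)
      (fun ⟨hs, hgd⟩ => ⟨hs, fun ⟨_, hj⟩ => hs.subset hj, hgd⟩)
  have hvalue : (fun n a i => if E n a i then g n a i else 0) ∈ stringComputable σ :=
    hP.isAttnValue_zero_mem_stringComputable c M hv fun n a i =>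
      (hcases n a i).imp (fun ⟨hE, j, hj, hgj⟩ => ⟨j, hj, by simp only [hE, hgj, if_true]⟩)
        (fun ⟨hs, hE, _⟩ => ⟨hs, if_neg hE⟩)
  have hexists : (fun n a i => if E n a i then 1 else 0) ∈ stringComputable σ :=
    hP.isAttnValue_zero_mem_stringComputable c M one_mem_stringComputable fun n a i =>
      (hcases n a i).imp (fun ⟨hE, j, hj, _⟩ => ⟨j, hj, if_pos hE⟩)
        (fun ⟨hs, hE, _⟩ => ⟨hs, if_neg hE⟩)
  convert add_mem hvalue (relu_mem_stringComputable (sub_mem hd hexists)) using 1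
  funext n a i
  simp only [Pi.add_apply, Pi.sub_apply]
  obtain ⟨h0, h1⟩ := hd01 n a i
  rcases hcases n a i with ⟨hE, _⟩ | ⟨_, hE, hgd⟩
  · simp [hE, h1]
  · simp [hE, hgd, h0]

/-! ### Equality of positions -/

/-- With margin `1 / N ^ 4`, the score `2 / (X * Y) - (1 / X ^ 2 + 1 / Y ^ 2)` tests whether the
integers `X` and `Y` in `[1, N]` are equal. -/
lemma two_mul_inv_sub_inv_sq_le {X Y N : ℕ} (hX : 0 < X) (hXN : X ≤ N) (hY : 0 < Y) (hYN : Y ≤ N)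
    (hne : X ≠ Y) :
    2 * (1 / X * (1 / Y)) - (1 / X ^ 2 + 1 / Y ^ 2) ≤ -(1 / (N : ℝ) ^ 4) := by
  have _ : (0 : ℝ) < X := by exact_mod_cast hX
  have _ : (0 : ℝ) < Y := by exact_mod_cast hY
  have hsq : (1 : ℝ) ≤ ((X : ℝ) - Y) ^ 2 := by
    have : (X : ℤ) - Y ≠ 0 := by omega
    exact_mod_cast (show (0 : ℤ) < ((X : ℤ) - Y) ^ 2 by positivity)
  have hden : ((X : ℝ) * Y) ^ 2 ≤ (N : ℝ) ^ 4 :=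
    calc ((X : ℝ) * Y) ^ 2 ≤ ((N : ℝ) * N) ^ 2 := by gcongr
      _ = (N : ℝ) ^ 4 := by ring
  have hscore : 2 * (1 / X * (1 / Y)) - (1 / X ^ 2 + 1 / Y ^ 2) =
      -(((X : ℝ) - Y) ^ 2 / (X * Y) ^ 2) := by
    field_simp
    ring
  rw [hscore]
  exact neg_le_neg (div_le_div₀ (by positivity) hsq (by positivity) hden)

lemma attendable_eq {x y : ∀ n, (Fin n → Option A) → Fin n → Fin n}
    (hx : (fun n a i => ((x n a i : ℕ) : ℝ) / n) ∈ stringComputable σ)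
    (hy : (fun n a i => ((y n a i : ℕ) : ℝ) / n) ∈ stringComputable σ) :
    Attendable σ fun n a i j => x n a i = y n a j := by
  have hcross := mul_mem_outer (lookup_mem_stringComputable hx inv_pos_mem_stringComputable)
    (lookup_mem_stringComputable hy inv_pos_mem_stringComputable)
  have hleft := mul_mem_outer (lookup_mem_stringComputable hx inv_sq_mem_stringComputable)
    (one_mem_stringComputable (σ := σ))
  have hright := mul_mem_outer (one_mem_stringComputable (σ := σ))
    (lookup_mem_stringComputable hy inv_sq_mem_stringComputable)
  refine ⟨_, sub_mem (Submodule.smul_mem _ 2 hcross) (add_mem hleft hright), _,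
    inv_succ_length_pow_mem_stringComputable 4, fun n a i => ⟨by positivity, fun j => ?_⟩⟩
  simp only [Pi.sub_apply, Pi.add_apply, Pi.smul_apply, Pi.one_apply, smul_eq_mul, mul_one,
    one_mul]
  refine ⟨fun h => ?_, fun h => ?_⟩
  · rw [h, ← sq, div_pow, one_pow]
    ring
  · have := two_mul_inv_sub_inv_sq_le (X := x n a i + 2) (Y := y n a j + 2) (N := n + 1)
      (by omega) (by omega) (by omega) (by omega) (by omega)
    exact_mod_cast this

/-! ### Truth values -/

variable {m : ℕ}

/-- The computable features with values in `{0, 1}`. -/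
def indicators (σ : Option A ≃ Fin k) : Submonoid (Feature A Fin) where
  carrier := {g | g ∈ stringComputable σ ∧ ∀ n a i, g n a i = 0 ∨ g n a i = 1}
  one_mem' := ⟨one_mem_stringComputable, fun _ _ _ => Or.inr rfl⟩
  mul_mem' {g h} hg hh := by
    refine ⟨?_, fun n a i => ?_⟩
    · convert relu_mem_stringComputable
        (sub_mem (add_mem hg.1 hh.1) one_mem_stringComputable) using 1
      funext n a i
      rcases hg.2 n a i with h₁ | h₁ <;> rcases hh.2 n a i with h₂ | h₂ <;> simp [h₁, h₂]
    · rcases hg.2 n a i with h₁ | h₁ <;> rcases hh.2 n a i with h₂ | h₂ <;> simp [h₁, h₂]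

/-- The algebra generated by the computable indicators. Products of indicators are indicators, so
it is their span and consists of computable features. -/
def finitary (σ : Option A ≃ Fin k) : Subalgebra ℝ (Feature A Fin) :=
  Algebra.adjoin ℝ (indicators σ)

lemma finitary_le_stringComputable :
    Subalgebra.toSubmodule (finitary σ) ≤ stringComputable σ := by
  rw [finitary, Algebra.adjoin_eq_span, Submonoid.closure_eq, Submodule.span_le]
  exact fun _ hg => hg.1

lemma indicator_mem_finitary {p : ∀ n, (Fin n → Option A) → Fin n → Prop}
    [∀ n a i, Decidable (p n a i)]
    (hp : (fun n a i => if p n a i then 1 else 0) ∈ stringComputable σ) :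
    (fun n a i => if p n a i then 1 else 0) ∈ finitary σ :=
  Algebra.subset_adjoin ⟨hp, fun _ _ _ => (ite_eq_or_eq _ _ _).symm⟩

/-- The algebra of functions of `m` positions that finitary features of the single positions
generate. -/
def multiFinitary (σ : Option A ≃ Fin k) (m : ℕ) :
    Subalgebra ℝ (Feature A fun n => Fin m → Fin n) :=
  ⨆ x, (finitary σ).map (pullback fun n (p : Fin m → Fin n) => p x)

lemma apply_mem_multiFinitary {g : Feature A Fin} (hg : g ∈ finitary σ) (x : Fin m) :
    (fun n a p => g n a (p x)) ∈ multiFinitary σ m := by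
  have hle := le_iSup (fun x : Fin m =>
    (finitary σ).map (pullback fun n (p : Fin m → Fin n) => p x)) x
  exact hle (Subalgebra.mem_map.2 ⟨g, hg, rfl⟩)

lemma diag_mem_finitary {F : Feature A fun n => Fin m → Fin n} (hF : F ∈ multiFinitary σ m) :
    (fun n a i => F n a fun _ => i) ∈ finitary σ := by
  have hle : multiFinitary σ m ≤ (finitary σ).comap (pullback fun n i _ => i) :=
    iSup_le fun x => by
      rintro _ ⟨g, hg, rfl⟩
      exact hg
  exact hle hF

lemma pair_mem_outer {F : Feature A fun n => Fin 2 → Fin n} (hF : F ∈ multiFinitary σ 2) :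
    (fun n a q => F n a ![q.1, q.2]) ∈ outer (stringComputable σ) (stringComputable σ) := by
  have hle : multiFinitary σ 2 ≤ ((finitary σ).map (pullback fun n => Prod.fst) ⊔
      (finitary σ).map (pullback fun n => Prod.snd)).comap (pullback fun n q => ![q.1, q.2]) := by
    refine iSup_le (Fin.forall_fin_two.2 ⟨?_, ?_⟩) <;> rintro _ ⟨g, hg, rfl⟩
    · exact le_sup_left (α := Subalgebra ℝ _) ⟨g, hg, rfl⟩
    · exact le_sup_right (α := Subalgebra ℝ _) ⟨g, hg, rfl⟩
  refine outer_mono finitary_le_stringComputable finitary_le_stringComputable ?_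
  rw [outer, ← Subalgebra.map_toSubmodule, ← Subalgebra.map_toSubmodule,
    Subalgebra.mul_toSubmodule]
  exact hle hF

lemma attendable_of_mem_multiFinitary {P : ∀ n, (Fin n → Option A) → Fin n → Fin n → Prop}
    [∀ n a i j, Decidable (P n a i j)] {F : Feature A fun n => Fin 2 → Fin n}
    (hF : F ∈ multiFinitary σ 2) (hFP : ∀ n a i j, F n a ![i, j] = if P n a i j then 1 else 0) :
    Attendable σ P := by
  refine ⟨_, pair_mem_outer (sub_mem hF (one_mem _)), 1, one_mem_stringComputable,
    fun n a i => ⟨one_pos, fun j => ?_⟩⟩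
  simp only [Pi.sub_apply, Pi.one_apply, hFP]
  exact ⟨fun h => by simp [h], fun h => by simp [h]⟩

section Comparisons

variable {x y : ∀ n, (Fin n → Option A) → Fin n → ℕ}
  (hx : (fun n a i => (x n a i : ℝ) / n) ∈ stringComputable σ)
  (hy : (fun n a i => (y n a i : ℝ) / n) ∈ stringComputable σ)
include hx hy

/-- Subtracting half a unit from the difference of two integers makes it nonzero. -/
lemma lt_mem_stringComputable :
    (fun n a i => if x n a i < y n a i then 1 else 0) ∈ stringComputable σ := by
  have hdiff (n a i) : (y n a i : ℝ) / n - x n a i / n - 1 / 2 * (1 / n) =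
      ((2 * y n a i - 2 * x n a i - 1 : ℤ) : ℝ) / (2 * n) := by
    push_cast
    ring
  have hn (n) (i : Fin n) : (0 : ℝ) < 2 * n := by
    have : (0 : ℝ) < n := by exact_mod_cast i.pos
    positivity
  convert isPos_mem_stringComputable
    (sub_mem (sub_mem hy hx) (Submodule.smul_mem _ (1 / 2) inv_length_mem_stringComputable))
    fun n a i => ?_ using 1
  · funext n a i
    refine if_congr ?_ rfl rfl
    simp only [Pi.sub_apply, Pi.smul_apply, smul_eq_mul]
    rw [hdiff, div_pos_iff_of_pos_right (hn n i), Int.cast_pos]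
    omega
  · simp only [Pi.sub_apply, Pi.smul_apply, smul_eq_mul]
    rw [hdiff]
    exact div_ne_zero (Int.cast_ne_zero.2 (by omega)) (hn n i).ne'

lemma le_mem_stringComputable :
    (fun n a i => if x n a i ≤ y n a i then 1 else 0) ∈ stringComputable σ := by
  convert sub_mem one_mem_stringComputable (lt_mem_stringComputable hy hx) using 4 with n a i
  rcases lt_or_ge (y n a i) (x n a i) with h | h
  · simp [h, h.not_ge]
  · simp [h, h.not_gt]

lemma eq_mem_stringComputable :
    (fun n a i => if x n a i = y n a i then 1 else 0) ∈ stringComputable σ := by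
  convert sub_mem (le_mem_stringComputable hx hy) (lt_mem_stringComputable hx hy)
    using 4 with n a i
  rcases lt_trichotomy (x n a i) (y n a i) with h | h | h
  · simp [h, h.le, h.ne]
  · simp [h]
  · simp [h.not_ge, h.not_gt, h.ne']

lemma cmp_mem_stringComputable (op : SRASP.Cmp) :
    (fun n a i => if op.test (x n a i) (y n a i) then 1 else 0) ∈ stringComputable σ := by
  cases op <;> simp only [SRASP.Cmp.test, decide_eq_true_eq]
  case eq => exact eq_mem_stringComputable hx hy
  case ne =>
    convert sub_mem one_mem_stringComputable (eq_mem_stringComputable hx hy) using 4 with n a i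
    by_cases h : x n a i = y n a i <;> simp [h]
  case lt => exact lt_mem_stringComputable hx hy
  case le => exact le_mem_stringComputable hx hy
  case gt => exact lt_mem_stringComputable hy hx
  case ge => exact le_mem_stringComputable hy hx

end Comparisons

lemma cond_mem_stringComputable {p : ∀ n, (Fin n → Option A) → Fin n → Bool}
    {g h : Feature A Fin} (hp : (fun n a i => if p n a i then 1 else 0) ∈ stringComputable σ)
    (hg : g ∈ stringComputable σ) (hh : h ∈ stringComputable σ)
    (hg01 : ∀ n a i, g n a i ∈ Set.Icc 0 1) (hh01 : ∀ n a i, h n a i ∈ Set.Icc 0 1) :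
    (fun n a i => bif p n a i then g n a i else h n a i) ∈ stringComputable σ := by
  convert add_mem
    (relu_mem_stringComputable (sub_mem (add_mem hg hp) one_mem_stringComputable))
    (relu_mem_stringComputable (sub_mem hh hp)) using 4 with n a i
  simp only [Pi.add_apply, Pi.sub_apply, Pi.one_apply]
  obtain ⟨hg0, hg1⟩ := hg01 n a i
  obtain ⟨hh0, hh1⟩ := hh01 n a i
  cases p n a i <;> simp [hg0, hg1, hh0, hh1]

/-! ### Values of programs -/

open SRASP

variable {Δ : Type}

/-- The indices of the coordinates that encode a value of type `τ`. -/
abbrev Coord (Δ : Type) : Ty → Type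
  | .bool => Unit
  | .char => Δ
  | .nat => Unit

/-- Truth values are encoded by `0` and `1`, symbols by one-hot vectors, and an integer `x` by
`x / n`. -/
def enc [DecidableEq Δ] (n : ℕ) : (τ : Ty) → Coord Δ τ → τ.Val Δ → ℝ
  | .bool, _, b => if b = true then 1 else 0
  | .char, δ, v => if v = δ then 1 else 0
  | .nat, _, x => Nat.cast x / n

/-- The integers that may occur in a vector of length `n` are less than `n`. -/
def IsValid (n : ℕ) : (τ : Ty) → τ.Val Δ → Prop
  | .bool, _ => True
  | .char, _ => True
  | .nat, x => Nat.lt x n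

lemma enc_mem_Icc [DecidableEq Δ] {n : ℕ} {τ : Ty} {v : τ.Val Δ} (hv : IsValid n τ v)
    (κ : Coord Δ τ) : enc n τ κ v ∈ Set.Icc 0 1 := by
  have indicator_mem (p : Prop) [Decidable p] : (if p then 1 else 0 : ℝ) ∈ Set.Icc 0 1 := by
    split_ifs <;> simp
  cases τ with
  | bool => exact indicator_mem _
  | char => exact indicator_mem _
  | nat =>
    exact ⟨by unfold enc; positivity,
      div_le_one_of_le₀ (Nat.cast_le.2 (le_of_lt hv)) (Nat.cast_nonneg n)⟩

/-- The vectors `g` are computed by an encoder, coordinate by coordinate. -/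
def Representable [DecidableEq Δ] (σ : Option A ≃ Fin k) (τ : Ty)
    (g : ∀ n, (Fin n → Option A) → Fin n → τ.Val Δ) : Prop :=
  (∀ κ, (fun n a i => enc n τ κ (g n a i)) ∈ stringComputable σ) ∧
    ∀ n a i, IsValid n τ (g n a i)

variable [DecidableEq Δ]

lemma Representable.cond {τ : Ty} {p : ∀ n, (Fin n → Option A) → Fin n → Bool}
    {g h : ∀ n, (Fin n → Option A) → Fin n → τ.Val Δ} (hp : Representable (Δ := Δ) σ .bool p)
    (hg : Representable σ τ g) (hh : Representable σ τ h) :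
    Representable σ τ fun n a i => bif p n a i then g n a i else h n a i := by
  refine ⟨fun κ => ?_, fun n a i => ?_⟩
  · simp only [Bool.apply_cond (enc _ τ κ)]
    exact cond_mem_stringComputable (hp.1 ()) (hg.1 κ) (hh.1 κ)
      (fun n a i => enc_mem_Icc (hg.2 n a i) κ) fun n a i => enc_mem_Icc (hh.2 n a i) κ
  · change IsValid n τ (bif p n a i then g n a i else h n a i)
    cases p n a i
    exacts [hh.2 n a i, hg.2 n a i]

lemma Representable.of_isAttnValue {τ : Ty} {g v d : ∀ n, (Fin n → Option A) → Fin n → τ.Val Δ}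
    {P : ∀ n, (Fin n → Option A) → Fin n → Fin n → Prop} (hP : Attendable σ P) (c : Choice)
    (M : SRASP.Mask) (hv : Representable σ τ v) (hd : Representable σ τ d)
    (hg : ∀ n a i, IsAttnValue c {j | M.test i j = true ∧ P n a i j} (v n a) (d n a i)
      (g n a i)) : Representable σ τ g := by
  refine ⟨fun κ => ?_, fun n a i => ?_⟩
  · exact hP.isAttnValue_mem_stringComputable c M (hv.1 κ) (hd.1 κ)
      (fun n a i => enc_mem_Icc (hd.2 n a i) κ) fun n a i => (hg n a i).map (enc n τ κ)
  · rcases hg n a i with ⟨j, -, hgj⟩ | ⟨-, hgd⟩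
    exacts [hgj ▸ hv.2 n a j, hgd ▸ hd.2 n a i]

/-! ### Integer operations -/

lemma clip_div {n : ℕ} (i : Fin n) (x : ℕ) :
    (clip n x : ℝ) / n = min ((x : ℝ) / n) (1 - 1 / n) := by
  have hn : (0 : ℝ) < n := by exact_mod_cast i.pos
  rw [clip, Nat.cast_min, Nat.cast_pred i.pos, ← min_div_div_right hn.le, sub_div, div_self hn.ne']

lemma natCast_sub_div (x y n : ℕ) : ((x - y : ℕ) : ℝ) / n = max 0 ((x : ℝ) / n - y / n) := by
  rw [← sub_div]
  rcases le_total y x with h | h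
  · have : (0 : ℝ) ≤ (x : ℝ) - y := sub_nonneg.2 (Nat.cast_le.2 h)
    rw [Nat.cast_sub h, max_eq_right (by positivity)]
  · rw [Nat.sub_eq_zero_of_le h, Nat.cast_zero, zero_div, max_eq_left]
    exact div_nonpos_of_nonpos_of_nonneg (sub_nonpos.2 (Nat.cast_le.2 h)) (Nat.cast_nonneg n)

section Integers

variable {x y : ∀ n, (Fin n → Option A) → Fin n → ℕ}

lemma representable_nat
    (hx : (fun n a i => (x n a i : ℝ) / n) ∈ stringComputable σ) (hlt : ∀ n a i, x n a i < n) :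
    Representable (Δ := Δ) σ .nat x :=
  ⟨fun _ => hx, hlt⟩

lemma representable_zero : Representable (A := A) (Δ := Δ) σ .nat fun _ _ _ => Nat.zero :=
  representable_nat (by simp only [Nat.cast_zero, zero_div]; exact zero_mem _) fun _ _ i => i.pos

lemma representable_clip
    (hx : (fun n a i => (x n a i : ℝ) / n) ∈ stringComputable σ) :
    Representable (Δ := Δ) σ .nat fun n a i => clip n (x n a i) := by
  refine representable_nat ?_ fun n a i => clip_lt i _
  convert min_mem_stringComputable hx
    (sub_mem one_mem_stringComputable inv_length_mem_stringComputable) using 4 with n a i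
  exact clip_div i _

lemma Representable.add (hx : Representable (Δ := Δ) σ .nat x)
    (hy : Representable (Δ := Δ) σ .nat y) :
    Representable (Δ := Δ) σ .nat fun n a i => clip n (x n a i + y n a i) := by
  refine representable_clip ?_
  simp only [Nat.cast_add, add_div]
  exact add_mem (hx.1 ()) (hy.1 ())

lemma Representable.sub (hx : Representable (Δ := Δ) σ .nat x)
    (hy : Representable (Δ := Δ) σ .nat y) :
    Representable (Δ := Δ) σ .nat fun n a i => x n a i - y n a i := by
  refine representable_nat ?_ fun n a i => (Nat.sub_le _ _).trans_lt (hx.2 n a i)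
  simp only [natCast_sub_div]
  exact relu_mem_stringComputable (sub_mem (hx.1 ()) (hy.1 ()))

end Integers

/-! ### Expressions -/

/-- Functions of `m` positions: truth values and symbols are represented by functions of all the
positions together, integers only where the positions coincide. -/
def MultiRepresentable (σ : Option A ≃ Fin k) {m : ℕ} :
    (τ : Ty) → (∀ n, (Fin n → Option A) → (Fin m → Fin n) → τ.Val Δ) → Prop
  | .nat, F => Representable σ .nat fun n a i => F n a fun _ => i
  | τ, F => ∀ κ, (fun n a p => enc n τ κ (F n a p)) ∈ multiFinitary σ m

lemma MultiRepresentable.diag {m : ℕ} {τ : Ty}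
    {F : ∀ n, (Fin n → Option A) → (Fin m → Fin n) → τ.Val Δ} (hF : MultiRepresentable σ τ F) :
    Representable σ τ fun n a i => F n a fun _ => i := by
  cases τ with
  | bool => exact ⟨fun κ => finitary_le_stringComputable (diag_mem_finitary (hF κ)),
      fun _ _ _ => trivial⟩
  | char => exact ⟨fun κ => finitary_le_stringComputable (diag_mem_finitary (hF κ)),
      fun _ _ _ => trivial⟩
  | nat => exact hF

lemma Representable.apply {m : ℕ} {τ : Ty} {g : ∀ n, (Fin n → Option A) → Fin n → τ.Val Δ}
    (hg : Representable σ τ g) (x : Fin m) :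
    MultiRepresentable σ τ fun n a (p : Fin m → Fin n) => g n a (p x) := by
  cases τ with
  | bool => exact fun κ => apply_mem_multiFinitary (indicator_mem_finitary (hg.1 κ)) x
  | char => exact fun κ => apply_mem_multiFinitary (indicator_mem_finitary (hg.1 κ)) x
  | nat => exact hg

section Encodings

variable {n : ℕ}

lemma enc_and (κ : Coord Δ .bool) (b c : Bool) :
    enc n .bool κ (Bool.and b c) = enc n .bool κ b * enc n .bool κ c := by
  cases b <;> cases c <;> simp [enc]

lemma enc_or (κ : Coord Δ .bool) (b c : Bool) :
    enc n .bool κ (Bool.or b c) =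
      enc n .bool κ b + enc n .bool κ c - enc n .bool κ b * enc n .bool κ c := by
  cases b <;> cases c <;> simp [enc]

lemma enc_not (κ : Coord Δ .bool) (b : Bool) :
    enc n .bool κ (Bool.not b) = 1 - enc n .bool κ b := by
  cases b <;> simp [enc]

lemma enc_cond {τ : Ty} (κ : Coord Δ τ) (c : Bool) (u v : τ.Val Δ) :
    enc n τ κ (bif c then u else v) =
      enc (Δ := Δ) n .bool () c * enc n τ κ u + (1 - enc (Δ := Δ) n .bool () c) * enc n τ κ v := by
  cases c <;> simp [enc]

lemma enc_decide_eq [Fintype Δ] (κ : Coord Δ .bool) (u v : Δ) :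
    enc n .bool κ (decide (u = v)) =
      ∑ δ, enc n .char δ u * enc n .char δ v := by
  simp [enc]

end Encodings

lemma MultiRepresentable.cond {m : ℕ} {τ : Ty}
    {c : ∀ n, (Fin n → Option A) → (Fin m → Fin n) → Bool}
    {F G : ∀ n, (Fin n → Option A) → (Fin m → Fin n) → τ.Val Δ}
    (hc : MultiRepresentable (Δ := Δ) σ .bool c) (hF : MultiRepresentable σ τ F)
    (hG : MultiRepresentable σ τ G) :
    MultiRepresentable σ τ fun n a p => bif c n a p then F n a p else G n a p := by
  have cond_mem {f g : Feature A fun n => Fin m → Fin n} (hf : f ∈ multiFinitary σ m)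
      (hg : g ∈ multiFinitary σ m) :=
    add_mem (mul_mem (hc ()) hf) (mul_mem (sub_mem (one_mem _) (hc ())) hg)
  cases τ with
  | nat => exact hc.diag.cond hF hG
  | bool | char =>
    intro κ
    convert cond_mem (hF κ) (hG κ) using 4
    exact enc_cond κ _ _ _

/-- All the vectors of the environments `ρ n a` are computed by encoders. -/
def RepresentableEnv (σ : Option A ≃ Fin k) {Θ : List Ty}
    (ρ : ∀ n, (Fin n → Option A) → Env Δ n Θ) : Prop :=
  ∀ τ (N : Name Θ τ), Representable σ τ fun n a => ρ n a τ N

variable {Θ : List Ty} {ρ : ∀ n, (Fin n → Option A) → Env Δ n Θ}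

lemma RepresentableEnv.multiRepresentable [Finite Δ] (hρ : RepresentableEnv σ ρ) {m : ℕ} {τ : Ty}
    (e : Expr Δ Θ m τ) : MultiRepresentable σ τ fun n a p => e.eval (ρ n a) p := by
  have := Fintype.ofFinite Δ
  induction e with
  | vec P x => exact (hρ _ P).apply x
  | ite a c b iha ihc ihb => exact ihc.cond iha ihb
  | top => exact fun _ => one_mem _
  | bot => exact fun _ => zero_mem _
  | and a b iha ihb =>
    intro κ
    simp only [Expr.eval, enc_and]
    exact mul_mem (iha κ) (ihb κ)
  | or a b iha ihb =>
    intro κ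
    simp only [Expr.eval, enc_or]
    exact sub_mem (add_mem (iha κ) (ihb κ)) (mul_mem (iha κ) (ihb κ))
  | not a iha =>
    intro κ
    simp only [Expr.eval, enc_not]
    exact sub_mem (one_mem _) (iha κ)
  | charEq a b iha ihb =>
    intro κ
    simp only [Expr.eval, enc_decide_eq]
    convert sum_mem fun δ (_ : δ ∈ Finset.univ) => mul_mem (iha δ) (ihb δ) using 1
    funext n a' p
    simp only [Finset.sum_apply, Pi.mul_apply]
  | cmp x op a b iha ihb =>
    have := cmp_mem_stringComputable (iha.1 ()) (ihb.1 ()) op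
    exact fun _ => apply_mem_multiFinitary (indicator_mem_finitary this) x
  | sym δ => exact fun δ' => algebraMap_mem (multiFinitary σ _) (if δ = δ' then 1 else 0)
  | zero => exact representable_zero
  | one =>
    refine representable_clip (x := fun _ _ _ => 1) ?_
    simpa using inv_length_mem_stringComputable
  | add a b iha ihb => exact iha.add ihb
  | sub a b iha ihb => exact iha.sub ihb

lemma RepresentableEnv.expr [Finite Δ] (hρ : RepresentableEnv σ ρ) {τ : Ty} (e : Expr Δ Θ 1 τ) :
    Representable σ τ fun n a i => e.eval (ρ n a) fun _ => i :=
  (hρ.multiRepresentable e).diag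

/-! ### Programs -/

lemma RepresentableEnv.attendable [Finite Δ] (hρ : RepresentableEnv σ ρ) (S : AttnPred Δ Θ) :
    Attendable σ fun n a i j => S.test (ρ n a) i j = true := by
  cases S with
  | expr e =>
    exact attendable_of_mem_multiFinitary (hρ.multiRepresentable e ()) fun _ _ _ _ => rfl
  | natEq V₁ V₂ =>
    have h₁ := hρ .nat V₁
    have h₂ := hρ .nat V₂
    simpa [AttnPred.test, Fin.ext_iff] using attendable_eq (x := fun n a i => ⟨_, h₁.2 n a i⟩)
      (y := fun n a i => ⟨_, h₂.2 n a i⟩) (h₁.1 ()) (h₂.1 ())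

lemma isAttnValue_op_eval {n : ℕ} {τ : Ty} (ρ : Env Δ n Θ) (c : Choice) (M : SRASP.Mask)
    (S : AttnPred Δ Θ) (V D : Expr Δ Θ 1 τ) (i : Fin n) :
    IsAttnValue c {j | M.test i j = true ∧ S.test ρ i j = true} (fun j => V.eval ρ fun _ => j)
      (D.eval ρ fun _ => i) ((Op.attn c M S V D).eval ρ i) := by
  simp only [Op.eval]
  split_ifs with h
  · cases c with
    | leftmost =>
      refine Or.inl ⟨_, ?_, rfl⟩
      simpa [IsChoice] using Finset.isLeast_min' _ h
    | rightmost =>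
      refine Or.inl ⟨_, ?_, rfl⟩
      simpa [IsChoice] using Finset.isGreatest_max' _ h
  · refine Or.inr ⟨?_, rfl⟩
    simpa [Finset.filter_eq_empty_iff, Set.eq_empty_iff_forall_notMem] using h

lemma RepresentableEnv.op [Finite Δ] (hρ : RepresentableEnv σ ρ) {τ : Ty} (op : Op Δ Θ τ) :
    Representable σ τ fun n a => op.eval (ρ n a) := by
  cases op with
  | pointwise e => exact hρ.expr e
  | attn c M S V D =>
    exact .of_isAttnValue (hρ.attendable S) c M (hρ.expr V) (hρ.expr D) fun n a i =>
      isAttnValue_op_eval (ρ n a) c M S V D i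
  | prefixSum V =>
    refine representable_nat ?_ fun n a i => clip_lt i _
    simpa [Op.eval, Finset.filter_ge_eq_Iic] using
      clip_sum_mem_stringComputable ((hρ.expr V).1 ())

lemma RepresentableEnv.cons (hρ : RepresentableEnv σ ρ) {τ : Ty}
    {g : ∀ n, (Fin n → Option A) → Fin n → τ.Val Δ} (hg : Representable σ τ g) :
    RepresentableEnv σ fun n a => (ρ n a).cons (g n a)
  | _, .here => hg
  | _, .there N => hρ _ N

lemma RepresentableEnv.code [Finite Δ] (c : Code Δ Θ) (hρ : RepresentableEnv σ ρ) :
    Representable σ .char fun n a => c.eval (ρ n a) := by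
  induction c with
  | out P => exact hρ .char P
  | define op _ ih => exact ih (hρ.cons (hρ.op op))

lemma representable_input (s : Option A → Δ) :
    Representable σ .char fun _ a i => s (a i) := by
  refine ⟨fun δ => ?_, fun _ _ _ => trivial⟩
  convert sum_mem fun c (_ : c ∈ Finset.univ) => Submodule.smul_mem (stringComputable σ)
    (if s (σ.symm c) = δ then (1 : ℝ) else 0) (input_mem_stringComputable c) using 1
  funext n a i
  simp only [Finset.sum_apply, Pi.smul_apply, smul_eq_mul]
  simp [enc]

lemma representableEnv_initEnv (s : Option A → Δ) :
    RepresentableEnv σ fun _ a => initEnv fun i => s (a i) :=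
  .cons (.cons (ρ := fun _ _ => Env.nil) (fun _ N => nomatch N)
    (representable_nat pos_mem_stringComputable fun _ _ i => i.isLt)) (representable_input s)

lemma enc_char_eq_iff {B : Type*} {k' n : ℕ} (γ : Option B ≃ Fin k') (s : Option B ↪ Δ) (v : Δ)
    (b : Option B) :
    (∀ c, enc n .char (s (γ.symm c)) v = if γ b = c then 1 else 0) ↔ v = s b := by
  refine ⟨fun h => ?_, ?_⟩
  · simpa [enc] using h (γ b)
  · rintro rfl c
    exact if_congr (by rw [s.injective.eq_iff, Equiv.eq_symm_apply]) rfl rfl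

end AHAT

theorem mainTheorem9_general {A B : Type*} {k k' : ℕ} (σ : Option A ≃ Fin k)
    (γ : Option B ≃ Fin k') (P : SRASP.Program A B) :
    ∃ T : AHAT.Encoder k k', ∀ n a b, T.Outputs σ γ n a b ↔ P.Outputs n a b := by
  let := P.decEqΔ
  let := P.fintypeΔ
  have hP := (AHAT.representableEnv_initEnv (σ := σ) P.inSym).code P.code
  choose f hf hf0 using fun c => AHAT.exists_extension_of_mem_stringComputable
    (hP.1 (P.outSym (γ.symm c)))
  obtain ⟨T, hT⟩ := AHAT.exists_encoder_of_forall_mem_computable hf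
  refine ⟨T, fun n a b => ?_⟩
  simp only [AHAT.Encoder.Outputs, SRASP.Program.Outputs, hT, hf0, AHAT.enc_char_eq_iff,
    implies_true, and_true, funext_iff]

end

theorem mainTheorem9 {A B : Type*} {k k' : ℕ} (σ : Option A ≃ Fin k) (γ : Option B ≃ Fin k')
    (P : SRASP.Program A B) (f : List A → List B) (q : ℕ → ℕ)
    (hP : ComputesWith P.Outputs f q) :
    ∃ T : AHAT.Encoder k k', ComputesWith (T.Outputs σ γ) f q := by
  obtain ⟨T, hT⟩ := mainTheorem9_general σ γ P
  exact ⟨T, hP.1, fun w =>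
    ⟨(hP.2 w).1, fun n hw hq => (hT n _ _).2 ((hP.2 w).2 n hw hq)⟩⟩
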